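/- Let $\mathcal T$ be a triangulated category with suspension $\Sigma$, and let $R=\bigoplus_{n\in\mathbb Z}R^n$ be a $\mathbb Z$-graded ring that is graded commutative, i.e. $rs=(-1)^{|r||s|}sr$ for homogeneous $r,s$. Let $R\to Z^*(\mathcal T)$ be a homomorphism of graded rings into the graded centre of $\mathcal T$, whose degree $n$ part consists of the natural transformations $\eta\colon\mathrm{id}\to\Sigma^n$ with $\eta\Sigma=(-1)^n\Sigma\eta$. Thus $\operatorname{Hom}^*_{\mathcal T}(X,Y)=\bigoplus_{n\in\mathbb Z}\operatorname{Hom}_{\mathcal T}(X,\Sigma^nY)$ is a graded $R$-module for all $X,Y\in\mathcal T$. Let $\operatorname{Spec}R$ be the set of homogeneous prime ideals of $R$ with the Zariski topology. A subset of $\operatorname{Spec}R$ is called Thomason if it is a union of subsets whose complements are Zariski open and quasi-compact. The Hochster dual $\operatorname{Spec}^\vee R$ is the same set with the topology generated by the subsets whose complement is Zariski open and quasi-compact. For $X\in\mathcal T$ and $\mathfrak p\in\operatorname{Spec}R$ write $X_{\mathfrak p}=0$ if the localisation $\operatorname{Hom}^*_{\mathcal T}(Y,X)_{\mathfrak p}$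 at the homogeneous elements outside $\mathfrak p$ vanishes for all $Y\in\mathcal T$. For an ideal $\mathfrak a$ of $R$ generated by finitely many homogeneous elements put $V(\mathfrak a)=\{\mathfrak p\in\operatorname{Spec}R\mid \mathfrak a\subseteq\mathfrak p\}$. If $Z=V(\mathfrak a)$, or if $Z=V(\mathfrak a)\cup V(\mathfrak b)$ for two such ideals, put $$\mathcal T_{Z}=\{X\in\mathcal T\mid X_{\mathfrak p}=0\text{ for all }\mathfrak p\in\operatorname{Spec}R\setminus Z\}.$$ The thick subcategories of $\mathcal T$ (full triangulated subcategories closed under direct summands) form a complete lattice under inclusion, with meet $\wedge$ the intersection and join $\vee$ the smallest thick subcategory containing the given ones. A thick subcategory $\mathcal U$ is called central if for every thick subcategory $\mathcal V$ every morphism between an object of $\mathcal U$ and an object of $\mathcal V$, in either direction, factors through an object of $\mathcal U\wedge\mathcal V$. The central thick subcategories, ordered by inclusion, form a frame whose finite meets and arbitrary joins are those of the lattice of all thick subcategories. Then the Thomason subsets of $\operatorname{Spec}R$ are precisely the open subsets of $\operatorname{Spec}^\vee R$, and the following hold. 1. For every ideal $\mathfrak a$ generated by finitely many homogeneous elements,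 the thick subcategory $\mathcal T_{V(\mathfrak a)}$ is central. 2. For all ideals $\mathfrak a,\mathfrak b$ each generated by finitely many homogeneous elements, $\mathcal T_{V(\mathfrak a)\cup V(\mathfrak b)}=\mathcal T_{V(\mathfrak a)}\vee\mathcal T_{V(\mathfrak b)}$. 3. The assignment $$V\longmapsto\mathcal T_V:=\bigvee_{V(\mathfrak a)\subseteq V}\mathcal T_{V(\mathfrak a)},$$ where $\mathfrak a$ runs through the ideals generated by finitely many homogeneous elements with $V(\mathfrak a)\subseteq V$, is a frame morphism (it preserves finite meets, including the top element, and arbitrary joins) from the frame of open subsets of $\operatorname{Spec}^\vee R$ to the frame of central thick subcategories of $\mathcal T$. -/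

import Mathlib

open CategoryTheory CategoryTheory.Limits CategoryTheory.Pretriangulated
open scoped DirectSum ZeroObject

universe w v u

attribute [-instance] CategoryTheory.catToReflQuiver

noncomputable section

namespace TriangularGeometry

/-! ### Thick subcategories -/

section Thick

variable {C : Type u} [Category.{v} C] [Preadditive C] [HasZeroObject C] [HasShift C ℤ]
  [∀ n : ℤ, (shiftFunctor C n).Additive] [Pretriangulated C]

variable (C) in
/-- A thick subcategory: a full triangulated subcategory, given by its objects, which is closed
under direct summands (in particular under isomorphisms). -/
@[ext]
structure ThickSubcategory where
  /-- the objects of the thick subcategory -/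
  carrier : ObjectProperty C
  isTriangulated : carrier.IsTriangulated
  isStableUnderRetracts : carrier.IsStableUnderRetracts

namespace ThickSubcategory

instance (U : ThickSubcategory C) : U.carrier.IsTriangulated := U.isTriangulated

instance (U : ThickSubcategory C) : U.carrier.IsStableUnderRetracts := U.isStableUnderRetracts

/-- Thick subcategories are ordered by inclusion. -/
instance : PartialOrder (ThickSubcategory C) := PartialOrder.lift carrier fun _ _ h =>
  ThickSubcategory.ext h

instance : InfSet (ThickSubcategory C) where
  sInf S :=
    { carrier := fun X => ∀ U ∈ S, U.carrier X
      isTriangulated :=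
        { exists_zero := ⟨0, isZero_zero C, fun U _ => U.carrier.prop_zero⟩
          isStableUnderShiftBy := fun a =>
            ⟨fun _ hX U hU => U.carrier.le_shift a _ (hX U hU)⟩
          ext₂' := fun T hT h₁ h₃ => ObjectProperty.le_isoClosure _ _ fun U hU =>
            U.carrier.ext_of_isTriangulatedClosed₂ T hT (h₁ U hU) (h₃ U hU) }
      isStableUnderRetracts :=
        ⟨fun r hY U hU => U.carrier.prop_of_retract r (hY U hU)⟩ }

instance : Min (ThickSubcategory C) where
  min U V :=
    { carrier := U.carrier ⊓ V.carrier
      isTriangulated := inferInstance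
      isStableUnderRetracts :=
        ⟨fun r hY => ⟨U.carrier.prop_of_retract r hY.1, V.carrier.prop_of_retract r hY.2⟩⟩ }

instance : Top (ThickSubcategory C) where
  top :=
    { carrier := ⊤
      isTriangulated :=
        { exists_zero := ⟨0, isZero_zero C, trivial⟩
          isStableUnderShiftBy := fun _ => ⟨fun _ _ => trivial⟩
          ext₂' := fun _ _ _ _ => ObjectProperty.le_isoClosure _ _ trivial }
      isStableUnderRetracts := ⟨fun _ _ => trivial⟩ }

/-- The complete lattice of thick subcategories: meets are intersections, and the join of a family
is the smallest thick subcategory containing all its members. -/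
instance : CompleteLattice (ThickSubcategory C) where
  __ := completeLatticeOfInf (ThickSubcategory C) fun _ =>
    ⟨fun _ hU _ hX => hX _ hU, fun _ hV X hX _ hU => hV hU X hX⟩
  inf := (· ⊓ ·)
  le_inf _ _ _ h₁ h₂ X hX := ⟨h₁ X hX, h₂ X hX⟩
  inf_le_left _ _ _ hX := hX.1
  inf_le_right _ _ _ hX := hX.2
  top := ⊤
  le_top _ _ _ := trivial

/-- A morphism factors through an object of the thick subcategory `P`. -/
def FactorsThrough (P : ThickSubcategory C) {X Y : C} (f : X ⟶ Y) : Prop :=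
  ∃ A : C, P.carrier A ∧ ∃ (g : X ⟶ A) (h : A ⟶ Y), g ≫ h = f

/-- Two thick subcategories commute if every morphism between an object of the one and an object of
the other, in either direction, factors through an object of their intersection. -/
def Commute (U V : ThickSubcategory C) : Prop :=
  (∀ ⦃X Y : C⦄, U.carrier X → V.carrier Y → ∀ f : X ⟶ Y, (U ⊓ V).FactorsThrough f) ∧
  (∀ ⦃X Y : C⦄, V.carrier X → U.carrier Y → ∀ f : X ⟶ Y, (U ⊓ V).FactorsThrough f)

/-- A thick subcategory is central if it commutes with all thick subcategories. -/
def IsCentral (U : ThickSubcategory C) : Prop := ∀ V : ThickSubcategory C, U.Commute V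

lemma FactorsThrough.mono {P Q : ThickSubcategory C} (hPQ : P ≤ Q) {X Y : C} {f : X ⟶ Y}
    (h : P.FactorsThrough f) : Q.FactorsThrough f := by
  obtain ⟨A, hA, e⟩ := h
  exact ⟨A, hPQ A hA, e⟩

lemma carrier_biprod (P : ThickSubcategory C) {A B : C} (hA : P.carrier A) (hB : P.carrier B) :
    P.carrier (A ⊞ B) :=
  P.carrier.ext_of_isTriangulatedClosed₂ _ (binaryBiproductTriangle_distinguished A B) hA hB

lemma FactorsThrough.add {P : ThickSubcategory C} {X Y : C} {f g : X ⟶ Y}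
    (hf : P.FactorsThrough f) (hg : P.FactorsThrough g) : P.FactorsThrough (f + g) := by
  obtain ⟨A, hA, a, b, rfl⟩ := hf
  obtain ⟨B, hB, c, d, rfl⟩ := hg
  exact ⟨A ⊞ B, P.carrier_biprod hA hB, biprod.lift a c, biprod.desc b d, by simp⟩

lemma FactorsThrough.shift {P : ThickSubcategory C} {X Y : C} {f : X ⟶ Y}
    (hf : P.FactorsThrough f) (n : ℤ) : P.FactorsThrough (f⟦n⟧') := by
  obtain ⟨A, hA, a, b, rfl⟩ := hf
  exact ⟨A⟦n⟧, P.carrier.le_shift n _ hA, a⟦n⟧', b⟦n⟧', by simp⟩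

lemma FactorsThrough.comp_left {P : ThickSubcategory C} {X Y Z : C} {f : X ⟶ Y}
    (hf : P.FactorsThrough f) (g : Z ⟶ X) : P.FactorsThrough (g ≫ f) := by
  obtain ⟨A, hA, a, b, rfl⟩ := hf
  exact ⟨A, hA, g ≫ a, b, by simp⟩

lemma FactorsThrough.comp_right {P : ThickSubcategory C} {X Y Z : C} {f : X ⟶ Y}
    (hf : P.FactorsThrough f) (g : Y ⟶ Z) : P.FactorsThrough (f ≫ g) := by
  obtain ⟨A, hA, a, b, rfl⟩ := hf
  exact ⟨A, hA, a, b ≫ g, by simp⟩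

/-- The objects all of whose morphisms to objects of `W` factor through `P ⊓ W`. -/
def leftFactor (P W : ThickSubcategory C) : ThickSubcategory C where
  carrier X := ∀ ⦃Y : C⦄, W.carrier Y → ∀ f : X ⟶ Y, (P ⊓ W).FactorsThrough f
  isTriangulated :=
    { exists_zero := ⟨0, isZero_zero C, fun _ _ f =>
        ⟨0, (P ⊓ W).carrier.prop_zero, 0, 0, (isZero_zero C).eq_of_src _ _⟩⟩
      isStableUnderShiftBy := fun n => ⟨fun X hX Y hY f => by
        have h := ((hX (W.carrier.le_shift (-n) _ hY)
          ((shiftShiftNeg X n).inv ≫ f⟦-n⟧')).shift n).comp_right (shiftNegShift Y n).hom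
        have e := (shiftEquiv C n).functor_unit_comp X
        have key : ((shiftShiftNeg X n).inv ≫ f⟦-n⟧')⟦n⟧' ≫ (shiftNegShift Y n).hom = f := by
          have e₁ : f⟦-n⟧'⟦n⟧' ≫ (shiftNegShift Y n).hom =
              (shiftNegShift (X⟦n⟧) n).hom ≫ f := by
            exact (shiftEquiv C n).counit.naturality f
          rw [Functor.map_comp, Category.assoc, e₁, ← Category.assoc]
          have e₂ : ((shiftShiftNeg X n).inv)⟦n⟧' ≫ (shiftNegShift (X⟦n⟧) n).hom = 𝟙 _ := e
          rw [e₂, Category.id_comp]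
        rwa [key] at h⟩
      ext₂' := fun T hT h₁ h₃ => ObjectProperty.le_isoClosure _ _ fun Y hY k => by
        obtain ⟨A, hA, u, v, huv⟩ := h₁ hY (T.mor₁ ≫ k)
        obtain ⟨Z, hZ, w, d, hT'⟩ := W.carrier.distinguished_cocone_triangle v hA.2 hY
        obtain ⟨t, ht₁, ht₂⟩ := complete_distinguished_triangle_morphism T _ hT hT' u k huv.symm
        obtain ⟨B, hB, t₁, t₂, rfl⟩ := h₃ hZ t
        obtain ⟨D, hD, i, p, hD'⟩ :=
          (P ⊓ W).carrier.distinguished_cocone_triangle₂ (t₂ ≫ d) hA hB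
        obtain ⟨h, -, hh₂⟩ : ∃ h : D ⟶ Y, i ≫ h = 𝟙 A ≫ v ∧ p ≫ t₂ = h ≫ w :=
          complete_distinguished_triangle_morphism₂ _ _ hD' hT' (𝟙 A) t₂
          ((congrArg _ ((shiftFunctor C (1 : ℤ)).map_id A)).trans (Category.comp_id _))
        obtain ⟨g, -, hg₂⟩ : ∃ g : T.obj₂ ⟶ D, T.mor₁ ≫ g = u ≫ i ∧ T.mor₂ ≫ t₁ = g ≫ p :=
          complete_distinguished_triangle_morphism₂ _ _ hT hD' u t₁
          (ht₂.trans (Category.assoc _ _ _))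
        replace ht₁ : T.mor₂ ≫ t₁ ≫ t₂ = k ≫ w := ht₁
        obtain ⟨e, he⟩ := Triangle.coyoneda_exact₂ _ hT' (k - g ≫ h) (by
          change (k - g ≫ h) ≫ w = 0
          rw [Preadditive.sub_comp, Category.assoc, ← hh₂, ← Category.assoc, ← hg₂,
            ← ht₁, Category.assoc, sub_self])
        have : k = g ≫ h + e ≫ v := by
          rw [← sub_eq_iff_eq_add']; exact he
        rw [this]
        exact FactorsThrough.add ⟨D, hD, g, h, rfl⟩ ⟨A, hA, e, v, rfl⟩ }
  isStableUnderRetracts := ⟨fun {X Z} r hZ Y hY f => by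
    have h := (hZ hY (r.r ≫ f)).comp_left r.i
    rwa [← Category.assoc, r.retract, Category.id_comp] at h⟩

/-- The objects such that all morphisms to them from objects of `W` factor through `P ⊓ W`. -/
def rightFactor (P W : ThickSubcategory C) : ThickSubcategory C where
  carrier X := ∀ ⦃Y : C⦄, W.carrier Y → ∀ f : Y ⟶ X, (P ⊓ W).FactorsThrough f
  isTriangulated :=
    { exists_zero := ⟨0, isZero_zero C, fun _ _ f =>
        ⟨0, (P ⊓ W).carrier.prop_zero, 0, 0, (isZero_zero C).eq_of_tgt _ _⟩⟩
      isStableUnderShiftBy := fun n => ⟨fun X hX Y hY f => by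
        have h := ((hX (W.carrier.le_shift (-n) _ hY)
          (f⟦-n⟧' ≫ (shiftShiftNeg X n).hom)).shift n).comp_left (shiftNegShift Y n).inv
        have key : (shiftNegShift Y n).inv ≫ (f⟦-n⟧' ≫ (shiftShiftNeg X n).hom)⟦n⟧' = f := by
          have e₁ : (shiftNegShift Y n).inv ≫ f⟦-n⟧'⟦n⟧' =
              f ≫ (shiftNegShift (X⟦n⟧) n).inv := by
            exact ((shiftEquiv C n).counitInv.naturality f).symm
          rw [Functor.map_comp, ← Category.assoc, e₁, Category.assoc]
          have e₂ : (shiftNegShift (X⟦n⟧) n).inv ≫ ((shiftShiftNeg X n).hom)⟦n⟧' = 𝟙 _ :=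
            (shiftEquiv C n).counitInv_functor_comp X
          rw [e₂, Category.comp_id]
        rwa [key] at h⟩
      ext₂' := fun T hT h₁ h₃ => ObjectProperty.le_isoClosure _ _ fun Y hY k => by
        obtain ⟨B, hB, u, v, huv⟩ := h₃ hY (k ≫ T.mor₂)
        obtain ⟨Z, hZ, w, d, hT'⟩ := W.carrier.distinguished_cocone_triangle₁ u hY hB.2
        obtain ⟨t, ht₁, ht₂⟩ := complete_distinguished_triangle_morphism₁ _ T hT' hT k v huv
        obtain ⟨A, hA, t₁, t₂, rfl⟩ := h₁ hZ t
        obtain ⟨D, hD, i, p, hD'⟩ :=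
          (P ⊓ W).carrier.distinguished_cocone_triangle₂ (d ≫ t₁⟦1⟧') hA hB
        obtain ⟨g, hg₁, -⟩ : ∃ g : Y ⟶ D, w ≫ g = t₁ ≫ i ∧ u ≫ 𝟙 B = g ≫ p :=
          complete_distinguished_triangle_morphism₂ _ _ hT' hD' t₁ (𝟙 B)
          (Category.id_comp _).symm
        obtain ⟨h, hh₁, -⟩ : ∃ h : D ⟶ T.obj₂, i ≫ h = t₂ ≫ T.mor₁ ∧ p ≫ v = h ≫ T.mor₂ :=
          complete_distinguished_triangle_morphism₂ _ _ hD' hT t₂ v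
          ((Category.assoc _ _ _).trans
            ((congrArg _ ((shiftFunctor C (1 : ℤ)).map_comp t₁ t₂).symm).trans ht₂))
        replace ht₁ : w ≫ k = (t₁ ≫ t₂) ≫ T.mor₁ := ht₁
        obtain ⟨e, he⟩ := Triangle.yoneda_exact₂ _ hT' (k - g ≫ h) (by
          change w ≫ (k - g ≫ h) = 0
          rw [Preadditive.comp_sub, ht₁, ← Category.assoc, hg₁, Category.assoc, Category.assoc,
            hh₁, sub_self])
        have : k = g ≫ h + u ≫ e := by
          rw [← sub_eq_iff_eq_add']; exact he
        rw [this]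
        exact FactorsThrough.add ⟨D, hD, g, h, rfl⟩ ⟨B, hB, u, e, rfl⟩ }
  isStableUnderRetracts := ⟨fun {X Z} r hZ Y hY f => by
    have h := (hZ hY (f ≫ r.i)).comp_right r.r
    rwa [Category.assoc, r.retract, Category.comp_id] at h⟩

lemma isCentral_sSup {S : Set (ThickSubcategory C)} (hS : ∀ U ∈ S, U.IsCentral) :
    (sSup S).IsCentral := by
  intro W
  have h₁ : sSup S ≤ leftFactor (sSup S) W := sSup_le fun U hU X hX Y hY f =>
    ((hS U hU W).1 hX hY f).mono (inf_le_inf_right W (le_sSup hU))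
  have h₂ : sSup S ≤ rightFactor (sSup S) W := sSup_le fun U hU X hX Y hY f =>
    ((hS U hU W).2 hY hX f).mono (inf_le_inf_right W (le_sSup hU))
  exact ⟨fun X Y hX hY f => h₁ X hX hY f, fun X Y hX hY f => h₂ Y hY hX f⟩

lemma IsCentral.inf {U V : ThickSubcategory C} (hU : U.IsCentral) (hV : V.IsCentral) :
    (U ⊓ V).IsCentral := by
  refine fun W => ⟨fun X Y hX hY f => ?_, fun X Y hX hY f => ?_⟩
  · obtain ⟨A, hA, a, b, rfl⟩ := (hV W).1 hX.2 hY f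
    exact (((hU (V ⊓ W)).1 hX.1 hA a).comp_right b).mono (inf_assoc U V W).ge
  · obtain ⟨A, hA, a, b, rfl⟩ := (hV W).2 hX hY.2 f
    exact (((hU (V ⊓ W)).2 hA hY.1 b).comp_left a).mono (inf_assoc U V W).ge

lemma isCentral_top : (⊤ : ThickSubcategory C).IsCentral := fun _ =>
  ⟨fun _ Y _ hY f => ⟨Y, ⟨trivial, hY⟩, f, 𝟙 Y, by simp⟩,
    fun X _ hX _ f => ⟨X, ⟨trivial, hX⟩, 𝟙 X, f, by simp⟩⟩

lemma sSup_inf_le {S : Set (ThickSubcategory C)} (hS : ∀ U ∈ S, U.IsCentral)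
    (V Q : ThickSubcategory C) (hQ : ∀ U ∈ S, U ⊓ V ≤ Q) : sSup S ⊓ V ≤ Q := by
  intro X hX
  have h : sSup S ≤ leftFactor Q V := sSup_le fun U hU Z hZ Y hY f =>
    ((hS U hU V).1 hZ hY f).mono (le_inf (hQ U hU) inf_le_right)
  obtain ⟨A, hA, a, b, hab⟩ := h X hX.1 hX.2 (𝟙 X)
  exact Q.carrier.prop_of_retract ⟨a, b, hab⟩ hA.1

end ThickSubcategory

variable (C) in
/-- The central thick subcategories, ordered by inclusion. -/
abbrev CentralThick : Type u := { U : ThickSubcategory C // U.IsCentral }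

namespace CentralThick

open ThickSubcategory

/-- Meets of finitely many and joins of arbitrarily many central thick subcategories are those
formed in the lattice of all thick subcategories. -/
instance : CompleteLattice (CentralThick C) where
  __ := @completeLatticeOfSup (CentralThick C) _
    ⟨fun S => ⟨sSup (Subtype.val '' S), isCentral_sSup (by rintro _ ⟨U, -, rfl⟩; exact U.2)⟩⟩
    fun S => ⟨fun U hU => le_sSup (α := ThickSubcategory C) ⟨U, hU, rfl⟩,
      fun _ hV => sSup_le (α := ThickSubcategory C) (by rintro _ ⟨U, hU, rfl⟩; exact hV hU)⟩
  inf U V := ⟨U.1 ⊓ V.1, U.2.inf V.2⟩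
  le_inf _ _ _ h₁ h₂ := le_inf (α := ThickSubcategory C) h₁ h₂
  inf_le_left _ _ := inf_le_left (α := ThickSubcategory C)
  inf_le_right _ _ := inf_le_right (α := ThickSubcategory C)
  top := ⟨⊤, isCentral_top⟩
  le_top _ := le_top (α := ThickSubcategory C)

lemma coe_sSup (S : Set (CentralThick C)) :
    ((sSup S : CentralThick C) : ThickSubcategory C) = sSup (Subtype.val '' S) := rfl

lemma coe_inf (U V : CentralThick C) :
    ((U ⊓ V : CentralThick C) : ThickSubcategory C) = U.1 ⊓ V.1 := rfl

lemma coe_top : ((⊤ : CentralThick C) : ThickSubcategory C) = ⊤ := rfl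

/-- The central thick subcategories form a frame. -/
instance : Order.Frame (CentralThick C) := .ofMinimalAxioms
  ⟨fun V S => by
    rw [inf_comm]
    refine sSup_inf_le (S := Subtype.val '' S) (by rintro _ ⟨U, -, rfl⟩; exact U.2) V.1 _ ?_
    rintro _ ⟨U, hU, rfl⟩
    have h : U ⊓ V ≤ ⨆ W ∈ S, V ⊓ W := by
      rw [inf_comm]
      exact le_iSup₂_of_le U hU le_rfl
    exact h⟩

end CentralThick

end Thick

/-! ### Graded commutative rings and their homogeneous prime ideals -/

section GradedRing

variable {R : Type w} [Ring R] (𝒜 : ℤ → AddSubgroup R)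

/-- A `ℤ`-graded ring is graded commutative if `r s = (-1)^{|r||s|} s r` for all homogeneous
elements `r` and `s`. -/
class IsGradedCommutative : Prop where
  mul_comm' : ∀ ⦃m n : ℤ⦄ ⦃r s : R⦄, r ∈ 𝒜 m → s ∈ 𝒜 n → r * s = (m * n).negOnePow • (s * r)

variable [GradedRing 𝒜]

lemma sq_commute [IsGradedCommutative 𝒜] {s : R} (hs : SetLike.IsHomogeneousElem 𝒜 s) (r : R) :
    s * s * r = r * (s * s) := by
  obtain ⟨n, hn⟩ := hs
  have hss : s * s ∈ 𝒜 (n + n) := SetLike.mul_mem_graded hn hn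
  induction r using DirectSum.Decomposition.inductionOn 𝒜 with
  | zero => simp
  | @homogeneous i r =>
    rw [IsGradedCommutative.mul_comm' hss r.2, ← two_mul, mul_assoc, Int.negOnePow_two_mul,
      one_smul]
  | add a b ha hb => rw [mul_add, add_mul, ha, hb]

/-- The homogeneous prime ideals of a graded commutative ring. Primality is expressed through
homogeneous elements, which is equivalent to primality in the usual sense; homogeneous left ideals
of a graded commutative ring are two-sided. -/
@[ext]
structure HomogeneousPrime where
  /-- the underlying homogeneous ideal -/
  ideal : HomogeneousIdeal 𝒜
  ne_top : ideal ≠ ⊤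
  mem_or_mem : ∀ ⦃r s : R⦄, SetLike.IsHomogeneousElem 𝒜 r → SetLike.IsHomogeneousElem 𝒜 s →
    r * s ∈ ideal → r ∈ ideal ∨ s ∈ ideal

variable {𝒜}

/-- The closed subset `V(a)` of all homogeneous prime ideals containing the ideal `a`. -/
def zeroLocus (a : Ideal R) : Set (HomogeneousPrime 𝒜) := {p | a ≤ p.ideal.toIdeal}

variable (𝒜) in
/-- The ideal `a` is generated by finitely many homogeneous elements. -/
def IsHomogeneousFG (a : Ideal R) : Prop :=
  ∃ s : Finset R, (∀ r ∈ s, SetLike.IsHomogeneousElem 𝒜 r) ∧ Ideal.span (s : Set R) = a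

/-- The Zariski topology, generated by the sets of homogeneous primes not containing a given
homogeneous element. These sets form a basis, and the closed sets are the sets `V(a)` for
homogeneous ideals `a`. -/
instance : TopologicalSpace (HomogeneousPrime 𝒜) :=
  TopologicalSpace.generateFrom
    {U | ∃ r : R, SetLike.IsHomogeneousElem 𝒜 r ∧ U = {p | r ∉ p.ideal}}

/-- The multiplicatively closed set of homogeneous elements that do not belong to `p`. -/
def HomogeneousPrime.complement (p : HomogeneousPrime 𝒜) : Submonoid R where
  carrier := {r | SetLike.IsHomogeneousElem 𝒜 r ∧ r ∉ p.ideal}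
  one_mem' := ⟨SetLike.isHomogeneousElem_one 𝒜, fun h => p.ne_top
    (HomogeneousIdeal.toIdeal_injective ((Ideal.eq_top_iff_one _).2 h))⟩
  mul_mem' hr hs := ⟨hr.1.mul hs.1, fun h => (p.mem_or_mem hr.1 hs.1 h).elim hr.2 hs.2⟩

/-- Homogeneous elements of a graded commutative ring commute with each other up to sign, hence one
may form left fractions with homogeneous denominators. -/
instance [IsGradedCommutative 𝒜] (p : HomogeneousPrime 𝒜) :
    OreLocalization.OreSet p.complement where
  ore_right_cancel r₁ r₂ s h := ⟨s * s, by
    have hs := sq_commute 𝒜 s.2.1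
    rw [Submonoid.coe_mul, hs, hs, ← mul_assoc, ← mul_assoc, h]⟩
  oreNum r s := r * s
  oreDenom _ s := s * s
  ore_eq r s := by rw [Submonoid.coe_mul, sq_commute 𝒜 s.2.1, mul_assoc]

end GradedRing

/-! ### Thomason subsets and the Hochster dual topology -/

section Hochster

/-- A subset of a topological space is Thomason if it is a union of subsets with quasi-compact open
complement. -/
def IsThomason {X : Type*} [TopologicalSpace X] (V : Set X) : Prop :=
  ∃ S : Set (Set X), (∀ W ∈ S, IsOpen Wᶜ ∧ IsCompact Wᶜ) ∧ V = ⋃₀ S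

/-- The Hochster dual of a topological space: the same set, with the topology generated by the
subsets whose complement is open and quasi-compact for the original topology. -/
def HochsterDual (X : Type*) : Type _ := X

instance (X : Type*) [TopologicalSpace X] : TopologicalSpace (HochsterDual X) :=
  TopologicalSpace.generateFrom {V : Set X | IsOpen Vᶜ ∧ IsCompact Vᶜ}

end Hochster

/-! ### Central ring actions -/

section Action

variable (C : Type u) [Category.{v} C] [Preadditive C] [HasShift C ℤ]
  [∀ n : ℤ, (shiftFunctor C n).Additive]

/-- The degree `n` part of the graded centre of `C`: the natural transformations
`η : 𝟭 ⟶ Σ^n` with `η Σ = (-1)^n Σ η`. -/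
def gradedCentre (n : ℤ) : AddSubgroup (∀ X : C, ShiftedHom X X n) where
  carrier := {η | (∀ ⦃X Y : C⦄ (f : X ⟶ Y), η X ≫ f⟦n⟧' = f ≫ η Y) ∧
    ∀ X : C, η (X⟦(1 : ℤ)⟧) =
      n.negOnePow • ((η X)⟦(1 : ℤ)⟧' ≫ (shiftFunctorComm C n 1).hom.app X)}
  zero_mem' := ⟨by simp, by simp⟩
  add_mem' := fun {η ζ} hη hζ => ⟨fun X Y f => by simp [hη.1 f, hζ.1 f], fun X => by
    simp only [Pi.add_apply, hη.2, hζ.2, Functor.map_add, Preadditive.add_comp, smul_add]⟩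
  neg_mem' := fun {η} hη => ⟨fun X Y f => by simp [hη.1 f], fun X => by
    simp only [Pi.neg_apply, hη.2, Functor.map_neg, Preadditive.neg_comp, smul_neg]⟩

variable {C} in
lemma shiftComm_add_inv (m n : ℤ) (X : C) :
    (shiftFunctorComm C n 1).hom.app (X⟦m⟧) ≫ ((shiftFunctorComm C m 1).hom.app X)⟦n⟧' ≫
      (shiftFunctorAdd C m n).inv.app (X⟦(1 : ℤ)⟧) =
    ((shiftFunctorAdd C m n).inv.app X)⟦(1 : ℤ)⟧' ≫
      (shiftFunctorComm C (m + n) 1).hom.app X := by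
  have k := shiftFunctorComm_hom_app_comp_shift_shiftFunctorAdd_hom_app (1 : ℤ) m n X
  have h : ∀ (i : ℤ) (Y : C),
      (shiftFunctorComm C i 1).hom.app Y = (shiftFunctorComm C 1 i).inv.app Y := fun i Y => by
    rw [← shiftFunctorComm_symm C 1 i, Iso.symm_hom]
  rw [h, h, h, ← cancel_epi ((shiftFunctorComm C 1 n).hom.app (X⟦m⟧)), Iso.hom_inv_id_app_assoc,
    ← cancel_epi (((shiftFunctorComm C 1 m).hom.app X)⟦n⟧'), ← Functor.map_comp_assoc,
    Iso.hom_inv_id_app, ← cancel_epi ((shiftFunctorAdd C m n).hom.app (X⟦(1 : ℤ)⟧)),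
    ← reassoc_of% k, ← Functor.map_comp_assoc, Iso.hom_inv_id_app]
  simp

/-- The unit of the graded centre. -/
def gradedCentreOne : gradedCentre C 0 :=
  ⟨fun X => ShiftedHom.mk₀ 0 rfl (𝟙 X), fun X Y f => by
    simp only [ShiftedHom.mk₀, shiftFunctorZero', eqToIso_refl, Iso.refl_trans, Category.id_comp]
    exact ((shiftFunctorZero C ℤ).inv.naturality f).symm, fun X => by
    simp only [ShiftedHom.mk₀, shiftFunctorZero', shiftFunctorZero_inv_app_shift, eqToIso_refl,
      Iso.refl_trans, Category.id_comp, Int.negOnePow_zero, one_smul]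
    congr 1
    exact congrArg (fun e : shiftFunctor C 1 ⋙ shiftFunctor C 0 ≅
      shiftFunctor C 0 ⋙ shiftFunctor C 1 => e.inv.app X) (shiftFunctorComm_symm C (0 : ℤ) 1).symm⟩

variable {C} in
/-- The product of `ζ` and `η` of degrees `m` and `n` in the graded centre is given at `X` by the
composite `X ⟶ Σ^n X ⟶ Σ^n (Σ^m X)` of `η` and `Σ^n ζ`. -/
def gradedCentreMul {m n : ℤ} (ζ : gradedCentre C m) (η : gradedCentre C n) :
    gradedCentre C (m + n) :=
  ⟨fun X => (η.1 X).comp (ζ.1 X) rfl, fun X Y f => by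
    simp only [ShiftedHom.comp, Category.assoc]
    rw [← reassoc_of% (η.2.1 f), ← NatTrans.naturality]
    simp only [Functor.comp_map, ← Functor.map_comp_assoc, ζ.2.1 f], fun X => by
    have n₁ := (shiftFunctorComm C n 1).hom.naturality (ζ.1 X)
    dsimp at n₁
    simp only [ShiftedHom.comp]
    rw [ζ.2.2, η.2.2, Int.negOnePow_add, mul_smul]
    simp only [Functor.map_comp, Category.assoc, Functor.map_zsmul, Units.smul_def,
      Linear.comp_smul, Preadditive.zsmul_comp, smul_smul, shiftFunctorAdd'_eq_shiftFunctorAdd]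
    rw [← reassoc_of% n₁, shiftComm_add_inv, mul_comm]⟩

variable {R : Type w} [Ring R] (𝒜 : ℤ → AddSubgroup R) [GradedRing 𝒜]

/-- A central action of the graded ring `R` on `C`: a homomorphism of graded rings from `R` to the
graded centre of `C`. -/
structure CentralAction where
  /-- the components of the homomorphism -/
  toCentre : ∀ n : ℤ, 𝒜 n →+ gradedCentre C n
  map_one : toCentre 0 ⟨1, SetLike.GradedOne.one_mem⟩ = gradedCentreOne C
  map_mul : ∀ (m n : ℤ) (r : 𝒜 m) (s : 𝒜 n),
    toCentre (m + n) ⟨r.1 * s.1, SetLike.mul_mem_graded r.2 s.2⟩ =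
      gradedCentreMul (toCentre m r) (toCentre n s)

namespace CentralAction

variable {C 𝒜} (φ : CentralAction C 𝒜)

/-- The graded abelian group `Hom^*(X, Y) = ⨁ n, Hom(X, Σ^n Y)`. -/
def GradedHom (_ : CentralAction C 𝒜) (X Y : C) : Type v := ⨁ n : ℤ, ShiftedHom X Y n

instance (X Y : C) : AddCommGroup (φ.GradedHom X Y) :=
  inferInstanceAs (AddCommGroup (⨁ n : ℤ, ShiftedHom X Y n))

/-- A homogeneous element of `R` acts on `Hom^*(X, Y)` through its image in the graded
endomorphisms of `Y`. -/
@[reducible]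
def gmodule (X Y : C) :
    DirectSum.Gmodule (fun n : ℤ => 𝒜 n) (fun n : ℤ => ShiftedHom X Y n) where
  smul {i _} r f := f.comp ((φ.toCentre i r).1 Y) rfl
  one_smul := fun ⟨n, f⟩ => by
    have h : ∀ (c c' : ℤ) (h : 0 + n = c) (h' : 0 + n = c'),
        (⟨c, f.comp ((φ.toCentre 0 ⟨1, SetLike.GradedOne.one_mem⟩).1 Y) h⟩ :
          GradedMonoid fun n : ℤ => ShiftedHom X Y n) =
        ⟨c', f.comp (ShiftedHom.mk₀ 0 rfl (𝟙 Y)) h'⟩ := by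
      rintro c _ rfl rfl
      rw [φ.map_one]
      rfl
    refine (h _ n rfl (zero_add n)).trans ?_
    rw [ShiftedHom.comp_mk₀_id]
  mul_smul := fun ⟨i, r⟩ ⟨j, s⟩ ⟨n, f⟩ => by
    have h : ∀ (c c' : ℤ) (h : i + j + n = c) (h' : i + j + n = c'),
        (⟨c, f.comp ((φ.toCentre (i + j) ⟨r.1 * s.1, SetLike.mul_mem_graded r.2 s.2⟩).1 Y) h⟩ :
          GradedMonoid fun n : ℤ => ShiftedHom X Y n) =
        ⟨c', (f.comp ((φ.toCentre j s).1 Y) rfl).comp ((φ.toCentre i r).1 Y)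
          ((add_assoc i j n).symm.trans h')⟩ := by
      rintro c _ rfl rfl
      rw [φ.map_mul]
      exact congrArg _ (ShiftedHom.comp_assoc _ _ _ rfl rfl rfl).symm
    exact h _ _ rfl (add_assoc i j n)
  smul_add r f g := ShiftedHom.add_comp _ _ _ _
  smul_zero r := ShiftedHom.zero_comp _ _ _ _
  add_smul r s f := by
    rw [map_add]
    exact ShiftedHom.comp_add _ _ _ _
  zero_smul f := by
    rw [map_zero]
    exact ShiftedHom.comp_zero _ _ _

instance (X Y : C) : Module R (φ.GradedHom X Y) :=
  letI := φ.gmodule X Y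
  letI : Module (⨁ n : ℤ, 𝒜 n) (φ.GradedHom X Y) :=
    inferInstanceAs (Module (⨁ n : ℤ, 𝒜 n) (⨁ n : ℤ, ShiftedHom X Y n))
  Module.compHom _ (DirectSum.decomposeRingEquiv 𝒜).toRingHom

/-- The inclusion of the morphisms of degree `n`. -/
def of (X Y : C) (n : ℤ) : ShiftedHom X Y n →+ φ.GradedHom X Y :=
  DirectSum.of (fun n : ℤ => ShiftedHom X Y n) n

lemma smul_of {X Y : C} {i n : ℤ} (r : 𝒜 i) (f : ShiftedHom X Y n) :
    r.1 • φ.of X Y n f = φ.of X Y (i + n) (f.comp ((φ.toCentre i r).1 Y) rfl) := by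
  let := φ.gmodule X Y
  change DirectSum.decomposeRingEquiv 𝒜 r.1 •
    (DirectSum.of (fun n : ℤ => ShiftedHom X Y n) n f) = _
  have h : DirectSum.decomposeRingEquiv 𝒜 r.1 = DirectSum.of (fun n : ℤ => 𝒜 n) i r :=
    DirectSum.decompose_coe 𝒜 r
  rw [h, DirectSum.Gmodule.of_smul_of]
  rfl

variable [IsGradedCommutative 𝒜]

/-- `X_p = 0`: the object `X` becomes zero when all the graded modules of morphisms
`Hom^*(Y, X)` are localised at the homogeneous prime `p`. -/
def VanishesAt (p : HomogeneousPrime 𝒜) (X : C) : Prop :=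
  ∀ Y : C, Subsingleton (OreLocalization p.complement (φ.GradedHom Y X))

lemma vanishesAt_iff (p : HomogeneousPrime 𝒜) (X : C) :
    φ.VanishesAt p X ↔ ∃ (i : ℤ) (r : 𝒜 i), r.1 ∉ p.ideal ∧ (φ.toCentre i r).1 X = 0 := by
  constructor
  · intro h
    have h₀ := (h X).elim (OreLocalization.oreDiv (S := p.complement)
      (φ.of X X 0 (ShiftedHom.mk₀ 0 rfl (𝟙 X))) 1) (OreLocalization.oreDiv 0 1)
    obtain ⟨s, r, h₁, h₂⟩ := OreLocalization.oreDiv_eq_iff.1 h₀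
    obtain ⟨⟨s, ⟨i, hi⟩, hs⟩, rfl⟩ : ∃ t : p.complement, t = s := ⟨s, rfl⟩
    simp only [OneMemClass.coe_one, mul_one] at h₂
    obtain rfl := h₂
    refine ⟨i, ⟨s, hi⟩, hs, ?_⟩
    have h₃ := h₁.symm.trans (smul_zero _)
    rw [φ.smul_of (⟨s, hi⟩ : 𝒜 i)] at h₃
    have h₄ := (DirectSum.of_injective (β := fun n : ℤ => ShiftedHom X X n) (i + 0))
      (h₃.trans (map_zero _).symm)
    have h₅ : ∀ (c : ℤ) (h : i + 0 = c) (g : ShiftedHom X X i),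
        (ShiftedHom.mk₀ 0 rfl (𝟙 X)).comp g h = 0 → c = i → g = 0 := by
      rintro c h g hg rfl
      rwa [ShiftedHom.mk₀_id_comp] at hg
    exact h₅ _ rfl _ h₄ (add_zero i)
  · rintro ⟨i, r, hr, hrX⟩ Y
    have key : ∀ f : φ.GradedHom Y X, r.1 • f = 0 := by
      intro f
      induction f using DirectSum.induction_on with
      | zero => exact smul_zero (A := φ.GradedHom Y X) r.1
      | of n f =>
        refine (φ.smul_of r f).trans ?_
        rw [hrX, ShiftedHom.comp_zero, map_zero]
      | add f g hf hg => exact (smul_add _ _ _).trans (by rw [hf, hg, add_zero])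
    refine subsingleton_of_forall_eq (OreLocalization.oreDiv 0 1) fun x => ?_
    induction x using OreLocalization.ind with
    | _ f s =>
      refine OreLocalization.oreDiv_eq_iff.2 ⟨⟨r.1, ⟨i, r.2⟩, hr⟩ * s, r.1, ?_, ?_⟩
      · exact (smul_zero _).trans (key f).symm
      · simp

lemma vanishesAt_zero [HasZeroObject C] (p : HomogeneousPrime 𝒜) : φ.VanishesAt p (0 : C) :=
  (φ.vanishesAt_iff p 0).2 ⟨0, ⟨1, SetLike.GradedOne.one_mem⟩, p.complement.one_mem.2,
    (isZero_zero C).eq_of_src _ _⟩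

lemma vanishesAt_of_retract {p : HomogeneousPrime 𝒜} {X Y : C} (e : Retract X Y)
    (hY : φ.VanishesAt p Y) : φ.VanishesAt p X := by
  obtain ⟨i, r, hr, h⟩ := (φ.vanishesAt_iff p Y).1 hY
  refine (φ.vanishesAt_iff p X).2 ⟨i, r, hr, ?_⟩
  have h₁ := (φ.toCentre i r).2.1 e.i
  rw [h, comp_zero] at h₁
  have h₂ : (φ.toCentre i r).1 X ≫ (e.i ≫ e.r)⟦i⟧' = 0 := by
    rw [Functor.map_comp, ← Category.assoc, h₁, zero_comp]
  rwa [e.retract, CategoryTheory.Functor.map_id, Category.comp_id] at h₂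

lemma vanishesAt_shift_one_iff (p : HomogeneousPrime 𝒜) (X : C) :
    φ.VanishesAt p (X⟦(1 : ℤ)⟧) ↔ φ.VanishesAt p X := by
  rw [φ.vanishesAt_iff, φ.vanishesAt_iff]
  refine exists_congr fun i => exists_congr fun r => and_congr_right fun _ => ?_
  rw [(φ.toCentre i r).2.2 X, smul_eq_zero_iff_eq]
  constructor
  · intro h
    apply (shiftFunctor C (1 : ℤ)).map_injective
    rw [Functor.map_zero, ← cancel_mono ((shiftFunctorComm C i 1).hom.app X), h, zero_comp]
  · intro h
    rw [h, Functor.map_zero, zero_comp]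

lemma vanishesAt_iff_of_iso {p : HomogeneousPrime 𝒜} {X Y : C} (e : X ≅ Y) :
    φ.VanishesAt p X ↔ φ.VanishesAt p Y :=
  ⟨φ.vanishesAt_of_retract e.symm.retract, φ.vanishesAt_of_retract e.retract⟩

lemma vanishesAt_shift {p : HomogeneousPrime 𝒜} {X : C} (hX : φ.VanishesAt p X) (n : ℤ) :
    φ.VanishesAt p (X⟦n⟧) := by
  induction n using Int.induction_on with
  | zero => exact (φ.vanishesAt_iff_of_iso ((shiftFunctorZero C ℤ).app X)).2 hX
  | succ n h =>
    exact (φ.vanishesAt_iff_of_iso ((shiftFunctorAdd C (n : ℤ) 1).app X)).2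
      ((φ.vanishesAt_shift_one_iff p _).2 h)
  | pred n h =>
    exact (φ.vanishesAt_shift_one_iff p _).1 ((φ.vanishesAt_iff_of_iso
      ((shiftFunctorAdd' C (-(n : ℤ) - 1) 1 (-(n : ℤ)) (by ring)).app X)).1 h)

variable [HasZeroObject C] [Pretriangulated C]

lemma vanishesAt_ext {p : HomogeneousPrime 𝒜} (T : Triangle C) (hT : T ∈ distTriang C)
    (h₁ : φ.VanishesAt p T.obj₁) (h₃ : φ.VanishesAt p T.obj₃) : φ.VanishesAt p T.obj₂ := by
  obtain ⟨i, r, hr, hr₁⟩ := (φ.vanishesAt_iff p _).1 h₁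
  obtain ⟨j, s, hs, hs₃⟩ := (φ.vanishesAt_iff p _).1 h₃
  refine (φ.vanishesAt_iff p _).2 ⟨i + j, ⟨r.1 * s.1, SetLike.mul_mem_graded r.2 s.2⟩,
    (p.complement.mul_mem ⟨⟨i, r.2⟩, hr⟩ ⟨⟨j, s.2⟩, hs⟩).2, ?_⟩
  have e₁ := (φ.toCentre i r).2.1 T.mor₁
  rw [hr₁, zero_comp] at e₁
  obtain ⟨t, ht⟩ := Triangle.yoneda_exact₂ T hT ((φ.toCentre i r).1 T.obj₂) e₁.symm
  have e₃ := (φ.toCentre j s).2.1 T.mor₂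
  rw [hs₃, comp_zero] at e₃
  rw [φ.map_mul]
  change ((φ.toCentre j s).1 T.obj₂).comp ((φ.toCentre i r).1 T.obj₂) rfl = 0
  rw [ShiftedHom.comp, ht, Functor.map_comp, Category.assoc, ← Category.assoc, e₃,
    zero_comp]

/-- The thick subcategory of all objects `X` such that `X_p = 0` for all homogeneous primes `p`
outside `Z`. For `Z = V(a)` this is the thick subcategory of objects supported on `V(a)`. -/
def supportedOn (Z : Set (HomogeneousPrime 𝒜)) : ThickSubcategory C where
  carrier X := ∀ p ∉ Z, φ.VanishesAt p X
  isTriangulated :=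
    { exists_zero := ⟨0, isZero_zero C, fun p _ => φ.vanishesAt_zero p⟩
      isStableUnderShiftBy := fun n => ⟨fun _ hX p hp => φ.vanishesAt_shift (hX p hp) n⟩
      ext₂' := fun T hT h₁ h₃ => ObjectProperty.le_isoClosure _ _ fun p hp =>
        φ.vanishesAt_ext T hT (h₁ p hp) (h₃ p hp) }
  isStableUnderRetracts := ⟨fun e hY p hp => φ.vanishesAt_of_retract e (hY p hp)⟩

/-- The join of the thick subcategories `supportedOn (V(a))`, taken over all ideals `a` that are
generated by finitely many homogeneous elements and satisfy `V(a) ⊆ V`. -/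
def thickOf (V : Set (HomogeneousPrime 𝒜)) : ThickSubcategory C :=
  ⨆ (a : Ideal R) (_ : IsHomogeneousFG 𝒜 a) (_ : zeroLocus a ⊆ V), φ.supportedOn (zeroLocus a)

end CentralAction

end Action

end TriangularGeometry

end

open TriangularGeometry

namespace TriangularGeometry

/-! ### Homogeneous ideals and homogeneous primes of a graded commutative ring. -/

section GradedRing

variable {R : Type w} [Ring R] {𝒜 : ℤ → AddSubgroup R} [GradedRing 𝒜]

/-! Two facts drive the proof. First, if `X` vanishes at every prime not containing a homogeneous
`r`, then a power of `r` acts as zero on `X`: otherwise a prime containing the annihilators of `X`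
would avoid `r` (`exists_toCentre_pow_eq_zero`). Secondly, the cone of `r` on any object is killed
by `r²`, hence supported on `V(r)` (`supportedOn_of_distinguished`).

Centrality: let a power `s` of `r` kill `X`, and let `Y` lie in a thick subcategory `V`. The cone of
`s` on `Y` lies in `V` and is supported on `V(r)`. By naturality a morphism between `X` and `Y` is
killed by `s`, so up to a shift it factors through this cone. Since `V(a)` is a finite intersection
of sets `V(r)`, and central subcategories are closed under meets, the general case follows.

Unions: if `P` contains the objects supported on `V(r)` and those supported on `V(s)`, then `r` and
`s` act invertibly modulo `P`. An object supported on `V(r) ∪ V(s) = V(rs)` is killed by a power of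
`rs`, so it is zero modulo `P`. Distributivity of the frame of central subcategories extends this to
several generators.

Frame morphism: finite meets reduce to `V(a) ∩ V(b) = V(a + b)` by distributivity. For joins, an
ultrafilter argument shows that a cover of `V(a)` by sets `V(b)` of finitely generated homogeneous
ideals has a finite subcover, to which the statement on unions applies. -/

lemma mul_mem_of_homogeneous_of_mem [IsGradedCommutative 𝒜] {I : Ideal R} {r s : R}
    (hr : SetLike.IsHomogeneousElem 𝒜 r) (hs : SetLike.IsHomogeneousElem 𝒜 s) (h : s * r ∈ I) :
    r * s ∈ I := by
  obtain ⟨m, hm⟩ := hr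
  obtain ⟨n, hn⟩ := hs
  rw [IsGradedCommutative.mul_comm' hm hn, Units.smul_def]
  exact zsmul_mem h _

/-- An `Ideal` is a left ideal here. The sign rule applies only to homogeneous elements, so `r` is
split into its components, which stay in `I` by homogeneity. -/
lemma mul_mem_right_of_isHomogeneous [IsGradedCommutative 𝒜] {I : Ideal R}
    (hI : I.IsHomogeneous 𝒜) {r s : R} (hr : r ∈ I) (hs : SetLike.IsHomogeneousElem 𝒜 s) :
    r * s ∈ I := by
  classical
  rw [← DirectSum.sum_support_decompose 𝒜 r, Finset.sum_mul]
  exact sum_mem fun i _ => mul_mem_of_homogeneous_of_mem ⟨i, SetLike.coe_mem _⟩ hs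
    (I.mul_mem_left _ (hI i hr))

lemma isHomogeneousElem_pow {r : R} (hr : SetLike.IsHomogeneousElem 𝒜 r) (n : ℕ) :
    SetLike.IsHomogeneousElem 𝒜 (r ^ n) := by
  obtain ⟨i, hi⟩ := hr
  exact ⟨n • i, SetLike.pow_mem_graded n hi⟩

/-- The elements whose product with a homogeneous element `t` lies in a homogeneous ideal. -/
def colon (J : HomogeneousIdeal 𝒜) {t : R} (ht : SetLike.IsHomogeneousElem 𝒜 t) :
    HomogeneousIdeal 𝒜 where
  carrier := {x | x * t ∈ J}
  add_mem' ha hb := by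
    change (_ + _) * t ∈ J.toIdeal
    rw [add_mul]
    exact J.toIdeal.add_mem ha hb
  zero_mem' := by
    change 0 * t ∈ J.toIdeal
    rw [zero_mul]
    exact J.toIdeal.zero_mem
  smul_mem' c x hx := by
    change c * x * t ∈ J.toIdeal
    rw [mul_assoc]
    exact J.toIdeal.mul_mem_left c hx
  is_homogeneous' i x hx := by
    obtain ⟨j, hj⟩ := ht
    have h := J.isHomogeneous (i + j) hx
    rwa [DirectSum.coe_decompose_mul_add_of_right_mem 𝒜 hj] at h

lemma le_colon [IsGradedCommutative 𝒜] (J : HomogeneousIdeal 𝒜) {t : R}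
    (ht : SetLike.IsHomogeneousElem 𝒜 t) : J ≤ colon J ht :=
  fun _ hx => mul_mem_right_of_isHomogeneous J.isHomogeneous hx ht

/-- A homogeneous ideal which contains no power of a homogeneous element `r` is contained in a
homogeneous prime ideal which does not contain `r`. -/
lemma exists_homogeneousPrime_notMem [IsGradedCommutative 𝒜] (I : HomogeneousIdeal 𝒜) {r : R}
    (hr : SetLike.IsHomogeneousElem 𝒜 r) (h : ∀ n : ℕ, r ^ n ∉ I) :
    ∃ p : HomogeneousPrime 𝒜, I ≤ p.ideal ∧ r ∉ p.ideal := by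
  obtain ⟨J, hIJ, hJ⟩ := zorn_le_nonempty₀ {J : HomogeneousIdeal 𝒜 | ∀ n : ℕ, r ^ n ∉ J}
    (fun c hc hc' K hK => by
      refine ⟨sSup c, fun n hn => ?_, fun _ => le_sSup⟩
      have hn : r ^ n ∈ (sSup c).toIdeal := hn
      rw [HomogeneousIdeal.toIdeal_sSup, iSup_subtype'] at hn
      have : Nonempty c := ⟨⟨K, hK⟩⟩
      obtain ⟨⟨L, hL⟩, hnL⟩ := (Submodule.mem_iSup_of_directed _ (by
        have := hc'.directedOn.directed_val
        exact this)).1 hn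
      exact hc hL n hnL) I h
  -- Maximality of `J`: every strictly larger homogeneous ideal contains a power of `r`.
  have key : ∀ K : HomogeneousIdeal 𝒜, J ≤ K → ∀ x ∈ K, x ∉ J → ∃ n : ℕ, r ^ n ∈ K := by
    intro K hK x hx hxJ
    by_contra! hn
    exact hxJ (hJ.2 hn hK hx)
  refine ⟨⟨J, ?_, ?_⟩, hIJ, ?_⟩
  · rintro rfl
    exact hJ.1 0 trivial
  · intro s t hs ht hst
    by_contra! hst'
    -- Two colon ideals replace the usual product of ideals. As `s ∈ (J : t)`, some `r ^ m * t` lies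
    -- in `J`; up to sign this says `t ∈ (J : r ^ m)`, so some `r ^ n * r ^ m` lies in `J`.
    obtain ⟨m, hm⟩ := key (colon J ht) (le_colon J ht) s hst hst'.1
    obtain ⟨n, hn⟩ := key (colon J (isHomogeneousElem_pow hr m)) (le_colon J _) t
      (mul_mem_of_homogeneous_of_mem ht (isHomogeneousElem_pow hr m) hm) hst'.2
    refine hJ.1 (n + m) ?_
    rw [pow_add]
    exact hn
  · intro hrJ
    refine hJ.1 1 ?_
    rwa [pow_one]

lemma HomogeneousPrime.one_notMem (p : HomogeneousPrime 𝒜) : (1 : R) ∉ p.ideal :=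
  p.complement.one_mem.2

lemma HomogeneousPrime.mem_of_pow_mem (p : HomogeneousPrime 𝒜) {r : R}
    (hr : SetLike.IsHomogeneousElem 𝒜 r) {n : ℕ} (h : r ^ n ∈ p.ideal) : r ∈ p.ideal := by
  by_contra hrp
  exact (p.complement.pow_mem (x := r) ⟨hr, hrp⟩ n).2 h

lemma HomogeneousPrime.mul_mem_iff [IsGradedCommutative 𝒜] (p : HomogeneousPrime 𝒜) {r s : R}
    (hr : SetLike.IsHomogeneousElem 𝒜 r) (hs : SetLike.IsHomogeneousElem 𝒜 s) :
    r * s ∈ p.ideal ↔ r ∈ p.ideal ∨ s ∈ p.ideal :=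
  ⟨p.mem_or_mem hr hs, fun h => h.elim
    (fun h => mul_mem_right_of_isHomogeneous p.ideal.isHomogeneous h hs)
    (fun h => p.ideal.toIdeal.mul_mem_left r h)⟩

/-! ### The closed sets `V(a)`, their quasi-compactness, and the Hochster dual. -/

lemma mem_zeroLocus_span {s : Set R} {p : HomogeneousPrime 𝒜} :
    p ∈ zeroLocus (Ideal.span s) ↔ s ⊆ p.ideal :=
  Ideal.span_le

lemma mem_zeroLocus_span_singleton {r : R} {p : HomogeneousPrime 𝒜} :
    p ∈ zeroLocus (Ideal.span {r}) ↔ r ∈ p.ideal := by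
  rw [mem_zeroLocus_span, Set.singleton_subset_iff]
  rfl

lemma zeroLocus_span_insert (r : R) (s : Set R) :
    zeroLocus (𝒜 := 𝒜) (Ideal.span (insert r s)) =
      zeroLocus (Ideal.span {r}) ∩ zeroLocus (Ideal.span s) := by
  ext p
  rw [Set.mem_inter_iff]
  simp only [mem_zeroLocus_span, Set.insert_subset_iff, Set.singleton_subset_iff]

lemma zeroLocus_span_empty : zeroLocus (𝒜 := 𝒜) (Ideal.span ∅) = Set.univ :=
  Set.eq_univ_of_forall fun _ => mem_zeroLocus_span.2 (Set.empty_subset _)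

lemma zeroLocus_sup (a b : Ideal R) :
    zeroLocus (𝒜 := 𝒜) (a ⊔ b) = zeroLocus a ∩ zeroLocus b :=
  Set.ext fun p => sup_le_iff (a := a) (b := b) (c := p.ideal.toIdeal)

lemma IsHomogeneousFG.span_singleton {r : R} (hr : SetLike.IsHomogeneousElem 𝒜 r) :
    IsHomogeneousFG 𝒜 (Ideal.span {r}) :=
  ⟨{r}, by simpa using hr, by simp⟩

lemma IsHomogeneousFG.sup {a b : Ideal R} (ha : IsHomogeneousFG 𝒜 a)
    (hb : IsHomogeneousFG 𝒜 b) : IsHomogeneousFG 𝒜 (a ⊔ b) := by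
  classical
  obtain ⟨s, hs, rfl⟩ := ha
  obtain ⟨t, ht, rfl⟩ := hb
  refine ⟨s ∪ t, fun r hr => (Finset.mem_union.1 hr).elim (hs r) (ht r), ?_⟩
  rw [Finset.coe_union, Ideal.span_union]

/-- The union of two closed sets defined by finitely many homogeneous elements is of this form. -/
lemma IsHomogeneousFG.exists_zeroLocus_eq_union [IsGradedCommutative 𝒜] {a b : Ideal R}
    (ha : IsHomogeneousFG 𝒜 a) (hb : IsHomogeneousFG 𝒜 b) :
    ∃ c : Ideal R, IsHomogeneousFG 𝒜 c ∧
      zeroLocus (𝒜 := 𝒜) c = zeroLocus a ∪ zeroLocus b := by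
  classical
  obtain ⟨s, hs, rfl⟩ := ha
  obtain ⟨t, ht, rfl⟩ := hb
  -- The ideal generated by the pairwise products of generators.
  refine ⟨_, ⟨Finset.image₂ (· * ·) s t, fun r hr => ?_, rfl⟩, ?_⟩
  · obtain ⟨x, hx, y, hy, rfl⟩ := Finset.mem_image₂.1 hr
    exact (hs x hx).mul (ht y hy)
  · ext p
    rw [Set.mem_union, mem_zeroLocus_span, mem_zeroLocus_span, mem_zeroLocus_span,
      Finset.coe_image₂, Set.image2_subset_iff]
    refine ⟨fun h => ?_, fun h x hx y hy => (p.mul_mem_iff (hs x hx) (ht y hy)).2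
      (h.imp (fun h => h hx) fun h => h hy)⟩
    by_contra! h'
    obtain ⟨⟨x, hx, hxp⟩, y, hy, hyp⟩ := h'.imp Set.not_subset.1 Set.not_subset.1
    exact ((p.mul_mem_iff (hs x hx) (ht y hy)).1 (h x hx y hy)).elim hxp hyp

/-- The homogeneous prime of all elements which belong to almost all homogeneous primes with
respect to an ultrafilter. -/
def HomogeneousPrime.ofUltrafilter (F : Ultrafilter (HomogeneousPrime 𝒜)) :
    HomogeneousPrime 𝒜 where
  ideal :=
    { carrier := {r | ∀ᶠ p : HomogeneousPrime 𝒜 in F, r ∈ p.ideal}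
      add_mem' := fun ha hb => by
        filter_upwards [ha, hb] with p hpa hpb using p.ideal.toIdeal.add_mem hpa hpb
      zero_mem' := .of_forall fun p => p.ideal.toIdeal.zero_mem
      smul_mem' := fun c x hx => by
        filter_upwards [hx] with p hp using p.ideal.toIdeal.mul_mem_left c hp
      is_homogeneous' := fun i x hx => by
        filter_upwards [hx] with p hp using p.ideal.isHomogeneous i hp }
  ne_top h := by
    have h₁ : ∀ᶠ p : HomogeneousPrime 𝒜 in F, (1 : R) ∈ p.ideal :=
      (HomogeneousIdeal.toIdeal_injective.eq_iff.2 h).ge trivial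
    obtain ⟨p, hp⟩ := h₁.exists
    exact p.one_notMem hp
  mem_or_mem r s hr hs h := Ultrafilter.eventually_or.1 (by
    have h : ∀ᶠ p : HomogeneousPrime 𝒜 in F, r * s ∈ p.ideal := h
    filter_upwards [h] with p hp using p.mem_or_mem hr hs hp)

/-- Finite generation makes `V(a)` a finite intersection of sets `V(r)`, and a filter contains such
an intersection exactly when it contains each of its terms. -/
lemma ofUltrafilter_mem_zeroLocus {F : Ultrafilter (HomogeneousPrime 𝒜)} {a : Ideal R}
    (ha : IsHomogeneousFG 𝒜 a) :
    HomogeneousPrime.ofUltrafilter F ∈ zeroLocus (𝒜 := 𝒜) a ↔ zeroLocus a ∈ F := by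
  obtain ⟨s, -, rfl⟩ := ha
  have h : zeroLocus (𝒜 := 𝒜) (Ideal.span (s : Set R)) = ⋂ r ∈ s, {p | r ∈ p.ideal} := by
    ext p
    rw [mem_zeroLocus_span, Set.mem_iInter₂]
    rfl
  rw [mem_zeroLocus_span, h, ← Ultrafilter.mem_coe, Filter.biInter_finset_mem]
  rfl

/-- Closed sets defined by finitely many homogeneous elements are quasi-compact with respect to
covers by sets of the same kind. -/
lemma exists_finset_zeroLocus_subset {a : Ideal R} (ha : IsHomogeneousFG 𝒜 a)
    {S : Set (Ideal R)} (hS : ∀ b ∈ S, IsHomogeneousFG 𝒜 b)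
    (h : zeroLocus (𝒜 := 𝒜) a ⊆ ⋃ b ∈ S, zeroLocus b) :
    ∃ T : Finset (Ideal R), (T : Set (Ideal R)) ⊆ S ∧
      zeroLocus (𝒜 := 𝒜) a ⊆ ⋃ b ∈ T, zeroLocus b := by
  classical
  by_contra! hT
  -- Without a finite subcover, `B` has the finite intersection property and lies in an ultrafilter.
  -- The limit prime belongs to `V(a)`, hence to some `V(b)`; then the ultrafilter contains both
  -- `V(b)` and its complement.
  let B : Set (Set (HomogeneousPrime 𝒜)) :=
    insert (zeroLocus a) ((fun b : Ideal R => (zeroLocus (𝒜 := 𝒜) b)ᶜ) '' S)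
  have hB : (Filter.generate B).NeBot := by
    rw [Filter.generate_neBot_iff]
    intro t htB ht
    have ht' : t \ {zeroLocus a} ⊆ (fun b : Ideal R => (zeroLocus (𝒜 := 𝒜) b)ᶜ) '' S := by
      rintro W ⟨hW, hWa⟩
      exact (htB hW).resolve_left hWa
    obtain ⟨T, hTS, hTt⟩ := Set.subset_image_iff.1 ht'
    -- Different ideals may have the same zero locus, so one ideal is chosen for each set in order
    -- to obtain a finite family.
    obtain ⟨T', hT'S, hTT'⟩ :=
      Set.exists_subset_bijOn T (fun b : Ideal R => (zeroLocus (𝒜 := 𝒜) b)ᶜ)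
    have hfin : T'.Finite := hTT'.finite_iff_finite.2 (hTt ▸ ht.sdiff)
    obtain ⟨p, hpa, hp⟩ := Set.not_subset.1 (hT hfin.toFinset (by
      rw [hfin.coe_toFinset]
      exact hT'S.trans hTS))
    refine ⟨p, fun W hW => ?_⟩
    by_cases hWa : W = zeroLocus a
    · exact hWa ▸ hpa
    · obtain ⟨b, hb, rfl⟩ : W ∈ (fun b : Ideal R => (zeroLocus (𝒜 := 𝒜) b)ᶜ) '' T' := by
        rw [hTT'.image_eq, hTt]
        exact ⟨hW, hWa⟩
      intro hpb
      exact hp (Set.mem_biUnion (hfin.mem_toFinset.2 hb) hpb)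
  have hF : ∀ W ∈ B, W ∈ Ultrafilter.of (Filter.generate B) := fun W hW =>
    Ultrafilter.of_le _ (Filter.mem_generate_of_mem hW)
  obtain ⟨b, hb, hFb⟩ := Set.mem_iUnion₂.1
    (h ((ofUltrafilter_mem_zeroLocus ha).2 (hF _ (Set.mem_insert _ _))))
  exact Ultrafilter.compl_notMem_iff.2 ((ofUltrafilter_mem_zeroLocus (hS b hb)).1 hFb)
    (hF _ (Set.mem_insert_of_mem _ ⟨b, hb, rfl⟩))

/-- The generating sets are closed under finite intersections: `D(r) ∩ D(s) = D(rs)`, and `D(1)` is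
the whole space. -/
lemma isTopologicalBasis_homogeneousPrime [IsGradedCommutative 𝒜] :
    TopologicalSpace.IsTopologicalBasis (Set.range
      fun r : {r : R // SetLike.IsHomogeneousElem 𝒜 r} =>
        {p : HomogeneousPrime 𝒜 | r.1 ∉ p.ideal}) := by
  have h : {U : Set (HomogeneousPrime 𝒜) | ∃ r : R, SetLike.IsHomogeneousElem 𝒜 r ∧
      U = {p | r ∉ p.ideal}} = Set.range
      fun r : {r : R // SetLike.IsHomogeneousElem 𝒜 r} =>
        {p : HomogeneousPrime 𝒜 | r.1 ∉ p.ideal} := by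
    ext U
    exact ⟨fun ⟨r, hr, hU⟩ => ⟨⟨r, hr⟩, hU.symm⟩, fun ⟨r, hU⟩ => ⟨r.1, r.2, hU.symm⟩⟩
  refine TopologicalSpace.isTopologicalBasis_of_subbasis_of_finiteInter
    (congrArg TopologicalSpace.generateFrom h) ⟨⟨⟨1, SetLike.isHomogeneousElem_one 𝒜⟩, ?_⟩, ?_⟩
  · exact Set.eq_univ_of_forall fun p => p.one_notMem
  · rintro _ ⟨⟨r, hr⟩, rfl⟩ _ ⟨⟨s, hs⟩, rfl⟩
    refine ⟨⟨r * s, hr.mul hs⟩, Set.ext fun p => ?_⟩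
    exact (not_congr (p.mul_mem_iff hr hs)).trans not_or

/-- The complements of the quasi-compact open subsets are closed sets defined by finitely many
homogeneous elements. -/
lemma exists_eq_zeroLocus [IsGradedCommutative 𝒜] {W : Set (HomogeneousPrime 𝒜)}
    (hW : IsOpen Wᶜ) (hW' : IsCompact Wᶜ) :
    ∃ a : Ideal R, IsHomogeneousFG 𝒜 a ∧ W = zeroLocus a := by
  obtain ⟨s, hs, hsW⟩ := eq_finite_iUnion_of_isTopologicalBasis_of_isCompact_open _
    isTopologicalBasis_homogeneousPrime _ hW' hW
  have hs' := hs.image Subtype.val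
  refine ⟨_, ⟨hs'.toFinset, fun r hr => ?_, rfl⟩, ?_⟩
  · obtain ⟨x, -, rfl⟩ := hs'.mem_toFinset.1 hr
    exact x.2
  · rw [hs'.coe_toFinset, ← compl_inj_iff, hsW]
    ext p
    rw [Set.mem_compl_iff, mem_zeroLocus_span, Set.image_subset_iff, Set.not_subset,
      Set.mem_iUnion₂]
    exact ⟨fun ⟨r, hr, h⟩ => ⟨r, hr, h⟩, fun ⟨r, hr, h⟩ => ⟨r, hr, h⟩⟩

end GradedRing

/-- The open subsets of the Hochster dual are the Thomason subsets. -/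
lemma isOpen_hochsterDual_iff {X : Type*} [TopologicalSpace X] (V : Set X) :
    IsOpen (X := HochsterDual X) V ↔ IsThomason V := by
  refine ⟨fun h => ?_, ?_⟩
  · have hI : FiniteInter {V : Set X | IsOpen Vᶜ ∧ IsCompact Vᶜ} :=
      ⟨by simp, fun s hs t ht => by
        rw [Set.mem_ofPred_eq, Set.compl_inter]
        exact ⟨hs.1.union ht.1, hs.2.union ht.2⟩⟩
    have hB : TopologicalSpace.IsTopologicalBasis (α := HochsterDual X)
        {V : Set X | IsOpen Vᶜ ∧ IsCompact Vᶜ} :=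
      TopologicalSpace.isTopologicalBasis_of_subbasis_of_finiteInter rfl hI
    obtain ⟨S, hS, hVS⟩ := hB.open_eq_sUnion h
    exact ⟨S, hS, hVS⟩
  · rintro ⟨S, hS, rfl⟩
    exact isOpen_sUnion (X := HochsterDual X) fun W hW =>
      TopologicalSpace.isOpen_generateFrom_of_mem (hS W hW)

/-- Open subsets of the Hochster dual are unions of closed sets defined by finitely many
homogeneous elements. -/
lemma exists_mem_zeroLocus_subset {R : Type w} [Ring R] {𝒜 : ℤ → AddSubgroup R} [GradedRing 𝒜]
    [IsGradedCommutative 𝒜] {V : Set (HomogeneousPrime 𝒜)}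
    (hV : IsOpen (X := HochsterDual (HomogeneousPrime 𝒜)) V) {p : HomogeneousPrime 𝒜}
    (hp : p ∈ V) :
    ∃ a : Ideal R, IsHomogeneousFG 𝒜 a ∧ p ∈ zeroLocus a ∧ zeroLocus a ⊆ V := by
  obtain ⟨S, hS, rfl⟩ := (isOpen_hochsterDual_iff V).1 hV
  obtain ⟨W, hW, hpW⟩ := hp
  obtain ⟨a, ha, rfl⟩ := exists_eq_zeroLocus (hS W hW).1 (hS W hW).2
  exact ⟨a, ha, hpW, Set.subset_sUnion_of_mem hW⟩

/-! ### Signs in the graded centre, and its action on cones. -/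

section Centre

variable {C : Type u} [Category.{v} C] [Preadditive C] [HasShift C ℤ]
  [∀ n : ℤ, (shiftFunctor C n).Additive]

/-- The formula `η Σ^m = (-1)^{d m} Σ^m η` for an element `η` of degree `d` of the graded
centre. -/
def CommutesWithShift {d : ℤ} (η : gradedCentre C d) (m : ℤ) : Prop :=
  ∀ X : C, η.1 (X⟦m⟧) =
    (d * m).negOnePow • ((η.1 X)⟦m⟧' ≫ (shiftFunctorComm C d m).hom.app X)

lemma commutesWithShift_zero {d : ℤ} (η : gradedCentre C d) : CommutesWithShift η 0 := by
  intro X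
  have h := (shiftFunctorZero C ℤ).hom.naturality (η.1 X)
  dsimp at h
  rw [mul_zero, Int.negOnePow_zero, one_smul, shiftFunctorComm_zero_hom_app, reassoc_of% h,
    η.2.1, Iso.hom_inv_id_app_assoc]

/-- Conjugation by `Σ^(m+1) ≅ Σ Σ^m` turns the formula for `m + 1` into `Σ` of the formula for `m`,
up to a sign. As `Σ` is faithful this is an equivalence, which serves the induction over `ℤ` in both
directions. -/
lemma commutesWithShift_add_one_iff {d : ℤ} (η : gradedCentre C d) (m : ℤ) :
    CommutesWithShift η (m + 1) ↔ CommutesWithShift η m := by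
  refine forall_congr' fun X => ?_
  have k := shiftFunctorComm_hom_app_comp_shift_shiftFunctorAdd_hom_app d m 1 X
  have n₁ := (shiftFunctorAdd C m 1).hom.naturality (η.1 X)
  dsimp at n₁
  rw [← cancel_epi ((shiftFunctorAdd C m 1).inv.app X),
    ← cancel_mono (((shiftFunctorAdd C m 1).hom.app X)⟦d⟧')]
  have e₁ : ((shiftFunctorAdd C m 1).inv.app X ≫ η.1 (X⟦m + 1⟧)) ≫
      ((shiftFunctorAdd C m 1).hom.app X)⟦d⟧' = η.1 (X⟦m⟧⟦(1 : ℤ)⟧) := by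
    rw [Category.assoc, η.2.1, Iso.inv_hom_id_app_assoc]
    rfl
  have e₂ : ((shiftFunctorAdd C m 1).inv.app X ≫
      ((d * (m + 1)).negOnePow •
        ((η.1 X)⟦m + 1⟧' ≫ (shiftFunctorComm C d (m + 1)).hom.app X))) ≫
      ((shiftFunctorAdd C m 1).hom.app X)⟦d⟧' =
      (d * (m + 1)).negOnePow • (((η.1 X)⟦m⟧' ≫ (shiftFunctorComm C d m).hom.app X)⟦(1 : ℤ)⟧' ≫
        (shiftFunctorComm C d 1).hom.app (X⟦m⟧)) := by
    simp only [Units.smul_def, Linear.comp_smul, Linear.smul_comp, Category.assoc]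
    rw [k, reassoc_of% n₁, Iso.inv_hom_id_app_assoc, Functor.map_comp, Category.assoc]
  rw [e₁, e₂, η.2.2, mul_add, mul_one, Int.negOnePow_add, mul_comm, mul_smul,
    smul_left_cancel_iff, Units.smul_def, Units.smul_def, ← Preadditive.zsmul_comp, cancel_mono,
    ← Functor.map_zsmul, (shiftFunctor C (1 : ℤ)).map_injective.eq_iff]

lemma commutesWithShift {d : ℤ} (η : gradedCentre C d) (m : ℤ) : CommutesWithShift η m := by
  induction m using Int.induction_on with
  | zero => exact commutesWithShift_zero η
  | succ m h => exact (commutesWithShift_add_one_iff η _).2 h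
  | pred m h =>
    rw [← commutesWithShift_add_one_iff]
    simpa using h

lemma gradedCentre_shift_self {d : ℤ} (η : gradedCentre C d) (X : C) :
    η.1 (X⟦d⟧) = (d * d).negOnePow • (η.1 X)⟦d⟧' := by
  rw [commutesWithShift η d X, shiftFunctorComm_eq_refl, Iso.refl_hom, NatTrans.id_app]
  congr 1
  exact Category.comp_id _

/-- The square of an element of the graded centre vanishes on its cones. -/
lemma gradedCentre_comp_self_eq_zero [HasZeroObject C] [Pretriangulated C] {d : ℤ}
    (η : gradedCentre C d) {Y Z : C} {g : Y⟦d⟧ ⟶ Z} {h : Z ⟶ Y⟦(1 : ℤ)⟧}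
    (hT : Triangle.mk (η.1 Y) g h ∈ distTriang C) : η.1 Z ≫ (η.1 Z)⟦d⟧' = 0 := by
  have hg : η.1 Y ≫ g = 0 := comp_distTriang_mor_zero₁₂ _ hT
  have hh : h ≫ (η.1 Y)⟦(1 : ℤ)⟧' = 0 := comp_distTriang_mor_zero₃₁ _ hT
  -- By naturality `g ≫ η_Z = η_{Σ^d Y} ≫ Σ^d g`, which up to sign is `Σ^d (η_Y ≫ g) = 0`. Hence
  -- `η_Z` factors through `h`.
  have e₁ : g ≫ η.1 Z = 0 := by
    rw [← η.2.1, gradedCentre_shift_self, Units.smul_def, Preadditive.zsmul_comp,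
      ← Functor.map_comp, hg, Functor.map_zero, smul_zero]
  obtain ⟨k, hk⟩ : ∃ k : Y⟦(1 : ℤ)⟧ ⟶ Z⟦d⟧, η.1 Z = h ≫ k :=
    Triangle.yoneda_exact₃ _ hT (η.1 Z) e₁
  have e₂ : h ≫ η.1 (Y⟦(1 : ℤ)⟧) = 0 := by
    rw [η.2.2, Units.smul_def, Preadditive.comp_zsmul, reassoc_of% hh, zero_comp, smul_zero]
  -- Naturality of `η` at the morphism `η_Z` itself gives `η_Z ≫ Σ^d η_Z = η_Z ≫ η_{Σ^d Z}`, with no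
  -- sign.
  calc η.1 Z ≫ (η.1 Z)⟦d⟧' = (h ≫ k) ≫ η.1 (Z⟦d⟧) := by rw [η.2.1, ← hk]
    _ = h ≫ η.1 (Y⟦(1 : ℤ)⟧) ≫ k⟦d⟧' := by rw [Category.assoc, η.2.1]
    _ = 0 := by rw [reassoc_of% e₂, zero_comp]

end Centre

/-! ### Desuspension, zero morphisms modulo a thick subcategory, and distributivity. -/

namespace ThickSubcategory

variable {C : Type u} [Category.{v} C] [Preadditive C] [HasZeroObject C] [HasShift C ℤ]
  [∀ n : ℤ, (shiftFunctor C n).Additive] [Pretriangulated C]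

lemma FactorsThrough.unshift {P : ThickSubcategory C} {X Y : C} {f : X ⟶ Y} {n : ℤ}
    (hf : P.FactorsThrough (f⟦n⟧')) : P.FactorsThrough f := by
  have h := ((hf.shift (-n)).comp_left (shiftShiftNeg X n).inv).comp_right (shiftShiftNeg Y n).hom
  have e : f⟦n⟧'⟦-n⟧' ≫ (shiftShiftNeg Y n).hom = (shiftShiftNeg X n).hom ≫ f :=
    (shiftEquiv C n).unitIso.inv.naturality f
  rwa [Category.assoc, e, Iso.inv_hom_id_assoc] at h

/-- If the zero morphism from an object has its cone in a thick subcategory, then so is the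
object. -/
lemma carrier_of_trW_zero (P : ThickSubcategory C) {X Y : C}
    (h : P.carrier.trW (0 : X ⟶ Y)) : P.carrier X := by
  obtain ⟨Z, g, k, hT, hZ⟩ := h
  -- The identity of `ΣX` is killed by the zero morphism `ΣX ⟶ ΣY`, so it lifts to the cone `Z`, and
  -- `ΣX` is a retract of `Z`.
  obtain ⟨l, hl⟩ : ∃ l : X⟦(1 : ℤ)⟧ ⟶ Z, 𝟙 _ = l ≫ k :=
    Triangle.coyoneda_exact₁ _ hT (𝟙 (X⟦(1 : ℤ)⟧)) (by
      change _ ≫ (0 : X ⟶ Y)⟦(1 : ℤ)⟧' = 0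
      rw [Functor.map_zero, comp_zero])
  exact (P.carrier.prop_shift_iff_of_isStableUnderShift X (1 : ℤ)).1
    (P.carrier.prop_of_retract ⟨l, k, hl.symm⟩ hZ)

lemma coe_sup_centralThick (U V : CentralThick C) :
    ((U ⊔ V : CentralThick C) : ThickSubcategory C) = U.1 ⊔ V.1 := by
  rw [← sSup_pair, CentralThick.coe_sSup, Set.image_pair, sSup_pair]

/-- Distributivity is inherited from the frame of central subcategories, whose binary meets and
joins are computed among all thick subcategories. -/
lemma inf_sup_of_isCentral {U V W : ThickSubcategory C} (hU : U.IsCentral) (hV : V.IsCentral)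
    (hW : W.IsCentral) : (U ⊓ V) ⊔ W = (U ⊔ W) ⊓ (V ⊔ W) := by
  have h := congrArg Subtype.val (sup_inf_right (⟨U, hU⟩ : CentralThick C) ⟨V, hV⟩ ⟨W, hW⟩)
  rwa [coe_sup_centralThick, CentralThick.coe_inf, CentralThick.coe_inf, coe_sup_centralThick,
    coe_sup_centralThick] at h

end ThickSubcategory

open ThickSubcategory

/-! ### Annihilators of objects. -/

namespace CentralAction

section

variable {C : Type u} [Category.{v} C] [Preadditive C] [HasShift C ℤ]
  [∀ n : ℤ, (shiftFunctor C n).Additive]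
  {R : Type w} [Ring R] {𝒜 : ℤ → AddSubgroup R} [GradedRing 𝒜] (φ : CentralAction C 𝒜)

lemma toCentre_mul_apply {i j : ℤ} (r : 𝒜 i) (s : 𝒜 j) (X : C) :
    (φ.toCentre (i + j) ⟨r.1 * s.1, SetLike.mul_mem_graded r.2 s.2⟩).1 X =
      ((φ.toCentre j s).1 X).comp ((φ.toCentre i r).1 X) rfl := by
  rw [φ.map_mul]
  rfl

/-- The identity as an element of the graded endomorphisms. -/
noncomputable def gradedId (X : C) : φ.GradedHom X X := φ.of X X 0 (ShiftedHom.mk₀ 0 rfl (𝟙 X))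

/-- Expresses annihilation of `X` inside an `R`-module, where it is also meaningful for
inhomogeneous elements and inherited by the left ideal they generate. -/
lemma smul_gradedId_eq_zero_iff {X : C} {i : ℤ} (r : 𝒜 i) :
    r.1 • φ.gradedId X = 0 ↔ (φ.toCentre i r).1 X = 0 := by
  rw [gradedId, φ.smul_of r]
  have h : ∀ (c : ℤ) (h : i + 0 = c) (g : ShiftedHom X X i), c = i →
      ((ShiftedHom.mk₀ 0 rfl (𝟙 X)).comp g h = 0 ↔ g = 0) := by
    rintro c h g rfl
    rw [ShiftedHom.mk₀_id_comp]
  rw [← h _ rfl _ (add_zero i)]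
  exact map_eq_zero_iff (φ.of X X (i + 0))
    (DirectSum.of_injective (β := fun n : ℤ => ShiftedHom X X n) (i + 0))

variable [IsGradedCommutative 𝒜]

/-- If `X_p` vanishes for all `p` not containing `r`, then a power of `r` annihilates `X`. -/
lemma exists_toCentre_pow_eq_zero {X : C} {i : ℤ} (r : 𝒜 i)
    (hX : ∀ p : HomogeneousPrime 𝒜, r.1 ∉ p.ideal → φ.VanishesAt p X) :
    ∃ n : ℕ, (φ.toCentre (n • i) ⟨r.1 ^ n, SetLike.pow_mem_graded n r.2⟩).1 X = 0 := by
  let S : Set R := {s | ∃ (j : ℤ) (t : 𝒜 j), s = t.1 ∧ (φ.toCentre j t).1 X = 0}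
  -- The left ideal generated by the homogeneous elements acting as zero on `X`. If it contains no
  -- power of `r`, some prime `p ⊇ I` avoids `r`; but `X_p = 0` provides an element of `I` outside
  -- `p`.
  let I : HomogeneousIdeal 𝒜 := ⟨Ideal.span S, Ideal.homogeneous_span 𝒜 _ (by
    rintro _ ⟨j, t, rfl, -⟩
    exact ⟨j, t.2⟩)⟩
  have hI : ∀ x ∈ Ideal.span S, x • φ.gradedId X = 0 := by
    intro x hx
    induction hx using Submodule.span_induction with
    | mem x hx =>
      obtain ⟨j, t, rfl, ht⟩ := hx
      exact (φ.smul_gradedId_eq_zero_iff t).2 ht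
    | zero => exact zero_smul R (φ.gradedId X)
    | add x y _ _ hx hy => rw [add_smul, hx, hy, add_zero]
    | smul c x _ hx => rw [smul_eq_mul, mul_smul, hx, smul_zero]
  by_contra! h
  obtain ⟨p, hp, hrp⟩ := exists_homogeneousPrime_notMem I ⟨i, r.2⟩ fun n hn =>
    h n ((φ.smul_gradedId_eq_zero_iff _).1 (hI _ hn))
  obtain ⟨j, t, ht, htX⟩ := (φ.vanishesAt_iff p X).1 (hX p hrp)
  exact ht (hp (Ideal.subset_span ⟨j, t, rfl, htX⟩))

end

variable {C : Type u} [Category.{v} C] [Preadditive C] [HasShift C ℤ] [HasZeroObject C]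
  [∀ n : ℤ, (shiftFunctor C n).Additive] [Pretriangulated C]
  {R : Type w} [Ring R] {𝒜 : ℤ → AddSubgroup R} [GradedRing 𝒜] [IsGradedCommutative 𝒜]
  (φ : CentralAction C 𝒜)

/-! ### Centrality and unions of supports. -/

lemma supportedOn_mono {Z W : Set (HomogeneousPrime 𝒜)} (h : Z ⊆ W) :
    φ.supportedOn Z ≤ φ.supportedOn W :=
  fun _ hX p hp => hX p fun hpZ => hp (h hpZ)

lemma supportedOn_univ : φ.supportedOn Set.univ = ⊤ :=
  top_le_iff.1 fun _ _ _ hp => (hp trivial).elim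

lemma supportedOn_inter (Z W : Set (HomogeneousPrime 𝒜)) :
    φ.supportedOn (Z ∩ W) = φ.supportedOn Z ⊓ φ.supportedOn W :=
  le_antisymm
    (le_inf (φ.supportedOn_mono Set.inter_subset_left) (φ.supportedOn_mono Set.inter_subset_right))
    fun _ hX p hp => (not_and_or.1 hp).elim (hX.1 p) (hX.2 p)

lemma supportedOn_empty : φ.supportedOn (∅ : Set (HomogeneousPrime 𝒜)) = ⊥ := by
  refine le_bot_iff.1 fun X hX => ?_
  -- With `r = 1`, the annihilating power is `1` itself, so the identity of `X` is zero.
  obtain ⟨n, hn⟩ := φ.exists_toCentre_pow_eq_zero (⟨1, SetLike.GradedOne.one_mem⟩ : 𝒜 0)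
    fun p _ => hX p (Set.notMem_empty p)
  have h : (1 : R) ^ n • φ.gradedId X = 0 := (φ.smul_gradedId_eq_zero_iff _).2 hn
  rw [one_pow, one_smul] at h
  have h₀ := DirectSum.of_injective (β := fun n : ℤ => ShiftedHom X X n) 0
    (h.trans (map_zero (φ.of X X 0)).symm)
  have h₁ : 𝟙 X = 0 := (ShiftedHom.homEquiv (0 : ℤ) rfl).injective
    (h₀.trans (ShiftedHom.mk₀_zero X X 0 rfl).symm)
  exact ObjectProperty.prop_of_isZero _ ((IsZero.iff_id_eq_zero X).2 h₁)

/-- The cone of the action of `r` on an object is supported on `V(r)`. -/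
lemma supportedOn_of_distinguished {i : ℤ} (r : 𝒜 i) {Y Z : C} {g : Y⟦i⟧ ⟶ Z}
    {h : Z ⟶ Y⟦(1 : ℤ)⟧} (hT : Triangle.mk ((φ.toCentre i r).1 Y) g h ∈ distTriang C) :
    (φ.supportedOn (zeroLocus (Ideal.span {r.1}))).carrier Z := by
  intro p hp
  rw [mem_zeroLocus_span_singleton] at hp
  -- The argument on cones annihilates `Z` by `r²` rather than `r`; primality keeps `r²` outside
  -- `p`.
  refine (φ.vanishesAt_iff p Z).2 ⟨i + i, ⟨r.1 * r.1, SetLike.mul_mem_graded r.2 r.2⟩,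
    fun h => hp (((p.mul_mem_iff ⟨i, r.2⟩ ⟨i, r.2⟩).1 h).elim id id), ?_⟩
  rw [φ.toCentre_mul_apply, ShiftedHom.comp,
    reassoc_of% (gradedCentre_comp_self_eq_zero (φ.toCentre i r) hT), zero_comp]

/-- For each `X` supported on `V(r)` one power `s` of `r` kills `X`, and the cones of `s` on the
objects of `V` are the intermediate objects. -/
lemma isCentral_supportedOn_span_singleton {r : R} (hr : SetLike.IsHomogeneousElem 𝒜 r) :
    (φ.supportedOn (zeroLocus (𝒜 := 𝒜) (Ideal.span {r}))).IsCentral := by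
  intro V
  obtain ⟨i, hi⟩ := hr
  have key : ∀ ⦃X : C⦄, (φ.supportedOn (zeroLocus (𝒜 := 𝒜) (Ideal.span {r}))).carrier X →
      ∃ (d : ℤ) (s : 𝒜 d), (φ.toCentre d s).1 X = 0 ∧ ∀ ⦃Y : C⦄, V.carrier Y →
        ∃ (Z : C) (g : Y⟦d⟧ ⟶ Z) (h : Z ⟶ Y⟦(1 : ℤ)⟧),
          Triangle.mk ((φ.toCentre d s).1 Y) g h ∈ distTriang C ∧
          (φ.supportedOn (zeroLocus (𝒜 := 𝒜) (Ideal.span {r})) ⊓ V).carrier Z := by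
    intro X hX
    obtain ⟨n, hn⟩ := φ.exists_toCentre_pow_eq_zero (⟨r, hi⟩ : 𝒜 i) (X := X) fun p hp =>
      hX p (mt mem_zeroLocus_span_singleton.1 hp)
    refine ⟨_, _, hn, fun Y hY => ?_⟩
    obtain ⟨Z, g, h, hT⟩ := distinguished_cocone_triangle
      ((φ.toCentre (n • i) ⟨r ^ n, SetLike.pow_mem_graded n hi⟩).1 Y)
    refine ⟨Z, g, h, hT, φ.supportedOn_mono ?_ Z (φ.supportedOn_of_distinguished _ hT),
      V.carrier.ext_of_isTriangulatedClosed₃ _ hT hY (V.carrier.le_shift _ _ hY)⟩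
    intro p hp
    rw [mem_zeroLocus_span_singleton] at hp ⊢
    exact p.mem_of_pow_mem ⟨i, hi⟩ hp
  constructor
  · intro X Y hX hY f
    obtain ⟨d, s, hs, hV⟩ := key hX
    obtain ⟨Z, g, h, hT, hZ⟩ := hV hY
    -- Since `f ≫ s_Y = s_X ≫ Σ^d f = 0`, the morphism `f` factors through the desuspended cone in
    -- the rotated triangle.
    obtain ⟨k, hk⟩ := Triangle.coyoneda_exact₂ _ (inv_rot_of_distTriang _ hT) f (by
      change f ≫ (φ.toCentre d s).1 Y = 0
      rw [← (φ.toCentre d s).2.1, hs, zero_comp])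
    exact ⟨_, ObjectProperty.le_shift _ (-1) _ hZ, k, _, hk.symm⟩
  · intro Y X hY hX f
    obtain ⟨d, s, hs, hV⟩ := key hX
    obtain ⟨Z, g, h, hT, hZ⟩ := hV hY
    -- In this direction `s_Y ≫ Σ^d f = f ≫ s_X = 0`, so it is `Σ^d f` that factors through the
    -- cone, and the factorisation is desuspended afterwards.
    obtain ⟨k, hk⟩ : ∃ k : Z ⟶ X⟦d⟧, f⟦d⟧' = g ≫ k :=
      Triangle.yoneda_exact₂ _ hT (f⟦d⟧') (by
        change (φ.toCentre d s).1 Y ≫ _ = 0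
        rw [(φ.toCentre d s).2.1, hs, comp_zero])
    exact FactorsThrough.unshift (n := d) ⟨Z, hZ, g, k, hk.symm⟩

/-- The thick subcategory of objects supported on `V(a)` is central. -/
lemma isCentral_supportedOn {a : Ideal R} (ha : IsHomogeneousFG 𝒜 a) :
    (φ.supportedOn (zeroLocus a)).IsCentral := by
  classical
  obtain ⟨s, hs, rfl⟩ := ha
  induction s using Finset.induction_on with
  | empty =>
    rw [Finset.coe_empty, zeroLocus_span_empty, supportedOn_univ]
    exact isCentral_top
  | insert r s _ ih =>
    rw [Finset.coe_insert, zeroLocus_span_insert, supportedOn_inter]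
    exact (φ.isCentral_supportedOn_span_singleton (hs r (Finset.mem_insert_self r s))).inf
      (ih fun x hx => hs x (Finset.mem_insert_of_mem hx))

/-- The elements of `R` acting on `X` with cone in `P` are closed under multiplication. -/
lemma trW_toCentre_mul [IsTriangulated C] (P : ThickSubcategory C) {i j : ℤ} {r : 𝒜 i} {s : 𝒜 j}
    {X : C} (hr : P.carrier.trW ((φ.toCentre i r).1 X))
    (hs : P.carrier.trW ((φ.toCentre j s).1 X)) {k : ℤ} (hk : i + j = k) (h : r.1 * s.1 ∈ 𝒜 k) :
    P.carrier.trW ((φ.toCentre k ⟨r.1 * s.1, h⟩).1 X) := by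
  subst hk
  rw [φ.toCentre_mul_apply]
  exact P.carrier.trW.comp_mem _ _ hs (P.carrier.trW.comp_mem _ _ (hr.shift j)
    (P.carrier.trW_of_isIso _))

lemma trW_toCentre_pow [IsTriangulated C] (P : ThickSubcategory C) {i : ℤ} {r : 𝒜 i} {X : C}
    (hr : P.carrier.trW ((φ.toCentre i r).1 X)) (n : ℕ) :
    P.carrier.trW ((φ.toCentre (n • i) ⟨r.1 ^ n, SetLike.pow_mem_graded n r.2⟩).1 X) := by
  induction n with
  | zero =>
    -- The degree is a variable so that the unit can be taken in degree `0 • i` as well as in degree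
    -- `0`.
    have : ∀ (k : ℤ) (hk : 0 = k) (h : (1 : R) ∈ 𝒜 k),
        P.carrier.trW ((φ.toCentre k ⟨1, h⟩).1 X) := by
      rintro _ rfl h
      rw [φ.map_one]
      exact P.carrier.trW.comp_mem _ _ (P.carrier.trW.id_mem X) (P.carrier.trW_of_isIso _)
    simp only [pow_zero]
    exact this _ (zero_nsmul i).symm _
  | succ n ih =>
    simp only [pow_succ]
    exact φ.trW_toCentre_mul P ih hr (succ_nsmul i n).symm _

/-- Modulo `P` both `r` and `s` act invertibly on `X`, because their cones lie in `P`. Yet a power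
of `rs` acts as zero, so `X` vanishes modulo `P`. -/
lemma supportedOn_union_span_singleton_le [IsTriangulated C] {P : ThickSubcategory C} {r s : R}
    (hr : SetLike.IsHomogeneousElem 𝒜 r) (hs : SetLike.IsHomogeneousElem 𝒜 s)
    (hrP : φ.supportedOn (zeroLocus (Ideal.span {r})) ≤ P)
    (hsP : φ.supportedOn (zeroLocus (Ideal.span {s})) ≤ P) :
    φ.supportedOn (zeroLocus (Ideal.span {r}) ∪ zeroLocus (Ideal.span {s})) ≤ P := by
  intro X hX
  have hcone : ∀ {i : ℤ} (t : 𝒜 i), φ.supportedOn (zeroLocus (Ideal.span {t.1})) ≤ P →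
      P.carrier.trW ((φ.toCentre i t).1 X) := by
    intro i t htP
    obtain ⟨Z, g, h, hT⟩ := distinguished_cocone_triangle ((φ.toCentre i t).1 X)
    exact ⟨Z, g, h, hT, htP Z (φ.supportedOn_of_distinguished t hT)⟩
  obtain ⟨i, hi⟩ := hr
  obtain ⟨j, hj⟩ := hs
  let t : 𝒜 (i + j) := ⟨r * s, SetLike.mul_mem_graded hi hj⟩
  have ht : P.carrier.trW ((φ.toCentre (i + j) t).1 X) :=
    φ.trW_toCentre_mul P (hcone ⟨r, hi⟩ hrP) (hcone ⟨s, hj⟩ hsP) rfl _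
  obtain ⟨n, hn⟩ := φ.exists_toCentre_pow_eq_zero t (X := X) fun p hp => hX p fun h => hp
      ((p.mul_mem_iff ⟨i, hi⟩ ⟨j, hj⟩).2 (h.imp mem_zeroLocus_span_singleton.1
        mem_zeroLocus_span_singleton.1))
  have h := φ.trW_toCentre_pow P ht n
  rw [hn] at h
  exact P.carrier_of_trW_zero h

/-- The objects supported on `V(a) ∪ V(b)` are generated by the ones supported on `V(a)` and the
ones supported on `V(b)`. -/
lemma supportedOn_union [IsTriangulated C] {a b : Ideal R} (ha : IsHomogeneousFG 𝒜 a)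
    (hb : IsHomogeneousFG 𝒜 b) :
    φ.supportedOn (zeroLocus a ∪ zeroLocus b) =
      φ.supportedOn (zeroLocus a) ⊔ φ.supportedOn (zeroLocus b) := by
  classical
  refine le_antisymm ?_ (sup_le (φ.supportedOn_mono Set.subset_union_left)
    (φ.supportedOn_mono Set.subset_union_right))
  -- Passes from principal ideals to arbitrary `a` in one argument, using `(V(r) ∩ V(a')) ∪ V(b) =
  -- (V(r) ∪ V(b)) ∩ (V(a') ∪ V(b))` and distributivity. It is applied once to each argument.
  have step : ∀ (b : Ideal R), IsHomogeneousFG 𝒜 b → (∀ r, SetLike.IsHomogeneousElem 𝒜 r →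
      φ.supportedOn (zeroLocus (Ideal.span {r}) ∪ zeroLocus b) ≤
        φ.supportedOn (zeroLocus (Ideal.span {r})) ⊔ φ.supportedOn (zeroLocus b)) →
      ∀ a, IsHomogeneousFG 𝒜 a → φ.supportedOn (zeroLocus a ∪ zeroLocus b) ≤
        φ.supportedOn (zeroLocus a) ⊔ φ.supportedOn (zeroLocus b) := by
    rintro b hb h _ ⟨s, hs, rfl⟩
    induction s using Finset.induction_on with
    | empty =>
      rw [Finset.coe_empty, zeroLocus_span_empty, supportedOn_univ, top_sup_eq]
      exact le_top
    | insert r s _ ih =>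
      have hr := hs r (Finset.mem_insert_self r s)
      have hs' : ∀ x ∈ s, SetLike.IsHomogeneousElem 𝒜 x := fun x hx =>
        hs x (Finset.mem_insert_of_mem hx)
      rw [Finset.coe_insert, zeroLocus_span_insert, Set.inter_union_distrib_right,
        supportedOn_inter, supportedOn_inter, inf_sup_of_isCentral
          (φ.isCentral_supportedOn_span_singleton hr) (φ.isCentral_supportedOn ⟨s, hs', rfl⟩)
          (φ.isCentral_supportedOn hb)]
      exact inf_le_inf (h r hr) (ih hs')
  refine step b hb (fun r hr => ?_) a ha
  rw [Set.union_comm, sup_comm]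
  refine step _ (.span_singleton hr) (fun s hs => ?_) b hb
  exact φ.supportedOn_union_span_singleton_le hs hr le_sup_left le_sup_right

/-! ### The frame morphism. -/

lemma thickOf_eq_sSup (V : Set (HomogeneousPrime 𝒜)) :
    φ.thickOf V = sSup {U | ∃ a : Ideal R, IsHomogeneousFG 𝒜 a ∧ zeroLocus a ⊆ V ∧
      φ.supportedOn (zeroLocus a) = U} :=
  le_antisymm (iSup_le fun a => iSup₂_le fun ha h => le_sSup ⟨a, ha, h, rfl⟩)
    (sSup_le (by
      rintro _ ⟨a, ha, h, rfl⟩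
      exact le_iSup_of_le a (le_iSup₂_of_le ha h le_rfl)))

lemma supportedOn_le_thickOf {V : Set (HomogeneousPrime 𝒜)} {a : Ideal R}
    (ha : IsHomogeneousFG 𝒜 a) (h : zeroLocus a ⊆ V) :
    φ.supportedOn (zeroLocus a) ≤ φ.thickOf V :=
  le_iSup_of_le a (le_iSup₂_of_le ha h le_rfl)

lemma isCentral_thickOf (V : Set (HomogeneousPrime 𝒜)) : (φ.thickOf V).IsCentral := by
  rw [thickOf_eq_sSup]
  refine isCentral_sSup ?_
  rintro _ ⟨a, ha, -, rfl⟩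
  exact φ.isCentral_supportedOn ha

lemma thickOf_mono {V W : Set (HomogeneousPrime 𝒜)} (h : V ⊆ W) :
    φ.thickOf V ≤ φ.thickOf W :=
  iSup_le fun _ => iSup₂_le fun ha haV => φ.supportedOn_le_thickOf ha (haV.trans h)

lemma thickOf_univ : φ.thickOf Set.univ = ⊤ := by
  rw [← top_le_iff, ← φ.supportedOn_univ, ← zeroLocus_span_empty]
  exact φ.supportedOn_le_thickOf ⟨∅, by simp, by simp⟩ le_rfl

lemma thickOf_inter (V W : Set (HomogeneousPrime 𝒜)) :
    φ.thickOf (V ∩ W) = φ.thickOf V ⊓ φ.thickOf W := by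
  refine le_antisymm (le_inf (φ.thickOf_mono Set.inter_subset_left)
    (φ.thickOf_mono Set.inter_subset_right)) ?_
  -- Both joins consist of central subcategories, so meets distribute over them, and it remains to
  -- treat `V(a) ∩ V(b) = V(a + b)`.
  rw [φ.thickOf_eq_sSup V]
  refine sSup_inf_le ?_ _ _ ?_
  · rintro _ ⟨a, ha, -, rfl⟩
    exact φ.isCentral_supportedOn ha
  · rintro _ ⟨a, ha, haV, rfl⟩
    rw [inf_comm, φ.thickOf_eq_sSup W]
    refine sSup_inf_le ?_ _ _ ?_
    · rintro _ ⟨b, hb, -, rfl⟩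
      exact φ.isCentral_supportedOn hb
    · rintro _ ⟨b, hb, hbW, rfl⟩
      rw [inf_comm, ← supportedOn_inter, ← zeroLocus_sup]
      refine φ.supportedOn_le_thickOf (ha.sup hb) ?_
      rw [zeroLocus_sup]
      exact Set.inter_subset_inter haV hbW

/-- The induction carries a finitely generated homogeneous ideal `c` whose zero locus is the partial
union, because the statement on unions applies only to such loci; the empty union is `V(1)`. -/
lemma supportedOn_biUnion_le [IsTriangulated C] {P : ThickSubcategory C} (T : Finset (Ideal R))
    (hT : ∀ b ∈ T, IsHomogeneousFG 𝒜 b ∧ φ.supportedOn (zeroLocus b) ≤ P) :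
    φ.supportedOn (⋃ b ∈ T, zeroLocus b) ≤ P := by
  classical
  obtain ⟨c, -, hc, hcP⟩ : ∃ c : Ideal R, IsHomogeneousFG 𝒜 c ∧
      zeroLocus (𝒜 := 𝒜) c = ⋃ b ∈ T, zeroLocus b ∧ φ.supportedOn (zeroLocus c) ≤ P := by
    induction T using Finset.induction_on with
    | empty =>
      have h : zeroLocus (𝒜 := 𝒜) (Ideal.span {1}) = ∅ := Set.eq_empty_of_forall_notMem
        fun p hp => p.one_notMem (mem_zeroLocus_span_singleton.1 hp)
      refine ⟨_, .span_singleton (SetLike.isHomogeneousElem_one 𝒜), by simpa using h, ?_⟩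
      rw [h, supportedOn_empty]
      exact bot_le
    | insert b T _ ih =>
      obtain ⟨c, hc, hcT, hcP⟩ := ih fun b hb => hT b (Finset.mem_insert_of_mem hb)
      have hb := hT b (Finset.mem_insert_self b T)
      obtain ⟨e, he, h⟩ := hb.1.exists_zeroLocus_eq_union hc
      refine ⟨e, he, ?_, ?_⟩
      · rw [h, Finset.set_biUnion_insert, hcT]
      · rw [h, φ.supportedOn_union hb.1 hc]
        exact sup_le hb.2 hcP
  rwa [← hc]

/-- A set `V(a)` inside the union is covered by sets `V(b)`, each contained in a member of `S`. By
quasi-compactness finitely many suffice, and the objects supported on their union lie in `P`. -/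
lemma thickOf_sUnion_le [IsTriangulated C] {S : Set (Set (HomogeneousPrime 𝒜))}
    (hS : ∀ V ∈ S, IsOpen (X := HochsterDual (HomogeneousPrime 𝒜)) V)
    {P : ThickSubcategory C} (hP : ∀ V ∈ S, φ.thickOf V ≤ P) : φ.thickOf (⋃₀ S) ≤ P := by
  refine iSup_le fun a => iSup₂_le fun ha haS => ?_
  obtain ⟨T, hT, haT⟩ := exists_finset_zeroLocus_subset (𝒜 := 𝒜) ha
    (S := {b | IsHomogeneousFG 𝒜 b ∧ ∃ V ∈ S, zeroLocus (𝒜 := 𝒜) b ⊆ V}) (fun b hb => hb.1)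
    fun p hp => by
      obtain ⟨V, hV, hpV⟩ := haS hp
      obtain ⟨b, hb, hpb, hbV⟩ := exists_mem_zeroLocus_subset (hS V hV) hpV
      exact Set.mem_biUnion (show b ∈ {b | _ ∧ _} from ⟨hb, V, hV, hbV⟩) hpb
  refine (φ.supportedOn_mono haT).trans (φ.supportedOn_biUnion_le T fun b hb => ?_)
  obtain ⟨hb', V, hV, hbV⟩ := hT hb
  exact ⟨hb', (φ.supportedOn_le_thickOf hb' hbV).trans (hP V hV)⟩

/-- The frame morphism from the open subsets of the Hochster dual of the spectrum to the central
thick subcategories. -/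
noncomputable def thickOfHom [IsTriangulated C] :
    FrameHom (TopologicalSpace.Opens (HochsterDual (HomogeneousPrime 𝒜))) (CentralThick C) where
  toFun V := ⟨φ.thickOf (V : Set (HochsterDual (HomogeneousPrime 𝒜))), φ.isCentral_thickOf _⟩
  map_inf' V W := Subtype.ext (φ.thickOf_inter _ _)
  map_top' := Subtype.ext φ.thickOf_univ
  map_sSup' S := by
    refine le_antisymm ?_ (sSup_le ?_)
    · change φ.thickOf _ ≤ Subtype.val (sSup _)
      rw [TopologicalSpace.Opens.coe_sSup, ← Set.sUnion_image]
      refine φ.thickOf_sUnion_le ?_ ?_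
      · rintro _ ⟨V, -, rfl⟩
        exact V.isOpen
      · rintro _ ⟨V, hV, rfl⟩
        exact le_sSup (α := CentralThick C) (a := ⟨φ.thickOf _, φ.isCentral_thickOf _⟩)
          ⟨V, hV, rfl⟩
    · rintro _ ⟨V, hV, rfl⟩
      exact φ.thickOf_mono (SetLike.coe_subset_coe.2 (le_sSup hV))

end CentralAction

end TriangularGeometry

theorem mainTheorem7 {C : Type u} [Category.{v} C] [Preadditive C] [HasZeroObject C]
    [HasShift C ℤ] [∀ n : ℤ, (shiftFunctor C n).Additive] [Pretriangulated C] [IsTriangulated C]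
    {R : Type w} [Ring R] (𝒜 : ℤ → AddSubgroup R) [GradedRing 𝒜] [IsGradedCommutative 𝒜]
    (φ : CentralAction C 𝒜) :
    (∀ V : Set (HomogeneousPrime 𝒜),
      IsOpen (X := HochsterDual (HomogeneousPrime 𝒜)) V ↔ IsThomason V) ∧
    (∀ a : Ideal R, IsHomogeneousFG 𝒜 a → (φ.supportedOn (zeroLocus a)).IsCentral) ∧
    (∀ a b : Ideal R, IsHomogeneousFG 𝒜 a → IsHomogeneousFG 𝒜 b →
      φ.supportedOn (zeroLocus a ∪ zeroLocus b) =
        φ.supportedOn (zeroLocus a) ⊔ φ.supportedOn (zeroLocus b)) ∧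
    ∃ F : FrameHom (TopologicalSpace.Opens (HochsterDual (HomogeneousPrime 𝒜))) (CentralThick C),
      ∀ V : TopologicalSpace.Opens (HochsterDual (HomogeneousPrime 𝒜)),
        (F V : ThickSubcategory C) = φ.thickOf (V : Set (HochsterDual (HomogeneousPrime 𝒜))) := by
  exact ⟨isOpen_hochsterDual_iff, fun _ => φ.isCentral_supportedOn, fun _ _ => φ.supportedOn_union,
    φ.thickOfHom, fun _ => rfl⟩
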